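/- **Theorem 2H (Semi-strong quantum Master Theorem for $\mathcal H$).** Let $r$ be a positive integer and $\mathbb A=\{1,\dots,r\}$. A biword $\binom uv$ is a word $\binom{x_1}{a_1}\cdots\binom{x_n}{a_n}$ ($n\ge 0$) of biletters with $x_i,a_i\in\mathbb A$, with top word $u=x_1\cdots x_n$ and bottom word $v=a_1\cdots a_n$; let $\mathcal B$ be the set of biwords, and $\mathcal A_q=\mathbb Z[q,q^{-1}]\langle\!\langle\mathcal B\rangle\!\rangle$ the algebra of formal, possibly infinite, sums of biwords, whose product extends concatenation. For a word $w$ let $\operatorname{inv} w$ be its number of inversions and $\overline w$ its non-decreasing rearrangement, and put $$\operatorname{Bos}(1)=\sum_{w\in\mathbb A^*}\binom{\overline w}{w},\qquad \operatorname{Ferm}(1)=\sum_{J\subset\mathbb A}(-1)^{|J|}\sum_{\sigma\in\mathfrak S_J}(-1)^{\operatorname{inv}\sigma}\binom{\sigma(i_1)\cdots\sigma(i_l)}{i_1\cdots i_l},$$ where $J=\{i_1<\dots<i_l\}$, $\mathfrak S_J$ is the group of permutations of $J$ and $\operatorname{inv}\sigma=\operatorname{inv}(\sigma(i_1)\cdots\sigma(i_l))$.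 The contextual reduction system $(SH)$ consists of the rules $$\binom{xy}{ab}\to\binom{yx}{ab}\ \text{ if } x>y,\ V(x,y,a,b)>0,\qquad \binom{xy}{ab}\to\binom{yx}{ba}\ \text{ if } x>y,\ V(x,y,a,b)<0,$$ where $V(x,y,a,b)=(a-x-\tfrac12)(a-y-\tfrac12)(b-x-\tfrac12)(b-y-\tfrac12)$. The leftmost reduction $[\ ]_{SH}:\mathcal A_q\to\mathcal A_q$ is the linear map, extended to infinite sums, that sends each biword to the biword obtained by applying repeatedly the rule that is applicable at the leftmost place, until no rule applies. For a biword $\alpha=\binom{x_1\cdots x_n}{a_1\cdots a_n}$ let $\operatorname{exc}\alpha=\#\{i: a_i>x_i\}$ and let $\operatorname{den}\alpha$ be the Denert statistic $\operatorname{den}\alpha=\#\{(i,j): i<j,\ a_i\in\,]\!]a_j,x_j]\!]\}$, where $]\!]a,x]\!]=\{c\in\mathbb A: a<c\le x\}$ if $a\le x$, and $]\!]a,x]\!]=\{c\in\mathbb A: c>a\text{ or }c\le x\}$ if $a>x$. Let $\psi:\mathcal A_q\to\mathbb Z[t,t^{-1},q,q^{-1}]\langle\!\langle\mathbb A^*\rangle\!\rangle$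 be the linear map, extended to infinite sums, with $\psi\binom uv=t^{\operatorname{exc}\binom uv}\,q^{\operatorname{den}\binom uv}\,u$. Then $$\psi\bigl([\operatorname{Ferm}(1)\times\operatorname{Bos}(1)]_{SH}\bigr)=1 .$$ -/

import Mathlib

open scoped LaurentPolynomial

/-! ### Words, biwords and formal sums -/

/-- The alphabet `{1, …, r}` is `Fin r`, with the element `i` standing for the letter `i + 1`.
A biletter `(x, a)` has the top letter `x` and the bottom letter `a`. -/
abbrev Biletter (r : ℕ) := Fin r × Fin r

/-- A biword is a word of biletters; the product of biwords is the concatenation. -/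
abbrev Biword (r : ℕ) := List (Biletter r)

/-- The ring `ℤ[q, q⁻¹]`. -/
abbrev CoeffQ := ℤ[T;T⁻¹]

/-- The ring `ℤ[t, t⁻¹, q, q⁻¹] = ℤ[q, q⁻¹][t, t⁻¹]`: the outer variable is `t`. -/
abbrev CoeffTQ := CoeffQ[T;T⁻¹]

/-- The large algebra `R⟨⟨X⟩⟩` of the (possibly infinite) formal sums `∑ c(w) w` of words `w` in
the letters of `X`; a formal sum is given by its coefficients `c(w)`. -/
def FormalSum (R X : Type*) := List X → R

namespace FormalSum

variable {R X : Type*}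

/-- The formal sum `1`: the empty word with the coefficient `1`. -/
instance [Zero R] [One R] : One (FormalSum R X) :=
  ⟨fun w => if w.isEmpty then 1 else 0⟩

/-- The product of formal sums that extends the concatenation of words: the coefficient of `w` is
the sum of `E w₁ * F w₂` over all factorizations `w = w₁ w₂`. -/
instance [Semiring R] : Mul (FormalSum R X) :=
  ⟨fun E F w => ∑ i ∈ Finset.range (w.length + 1), E (w.take i) * F (w.drop i)⟩

end FormalSum

/-! ### Bosons and fermions -/

/-- The number of inversions of a word `x₁ ⋯ xₙ`: the number of `i < j` with `xᵢ > xⱼ`. -/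
def wordInv {r : ℕ} : List (Fin r) → ℕ
  | [] => 0
  | x :: w => w.countP (fun y => y < x) + wordInv w

/-- `Bos(c) = ∑_w c ^ inv w (w̄ over w)`, with `w̄` the non-decreasing rearrangement of `w`: a biword
`(u over v)` occurs in it exactly if `u = v̄`, and then with the coefficient `c ^ inv v`. -/
noncomputable def Bos (r : ℕ) (c : CoeffQ) : FormalSum CoeffQ (Biletter r) :=
  fun β => if β.map Prod.fst = (β.map Prod.snd).insertionSort (· ≤ ·)
    then c ^ wordInv (β.map Prod.snd) else 0

/-- For `J = {i₁ < ⋯ < iₗ}` and a permutation `σ` of `J`, the biword with the top word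
`σ(i₁) ⋯ σ(iₗ)` and the bottom word `i₁ ⋯ iₗ`. -/
def permBiword {r : ℕ} (J : Finset (Fin r)) (σ : Equiv.Perm J) : Biword r :=
  List.ofFn fun k : Fin J.card =>
    ((σ (J.orderIsoOfFin rfl k) : Fin r), (J.orderIsoOfFin rfl k : Fin r))

/-- `Ferm(c) = ∑_J (-1) ^ |J| ∑_σ (-c) ^ inv σ (σ(i₁) ⋯ σ(iₗ) over i₁ ⋯ iₗ)`, where `J` runs over
the subsets of the alphabet and `σ` over the permutations of `J`. -/
noncomputable def Ferm (r : ℕ) (c : CoeffQ) : FormalSum CoeffQ (Biletter r) :=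
  fun β => ∑ J : Finset (Fin r), (-1) ^ J.card * ∑ σ : Equiv.Perm J,
    (-c) ^ wordInv ((permBiword J σ).map Prod.fst) * (if β = permBiword J σ then 1 else 0)

/-! ### Reduction systems and the leftmost reduction -/

/-- The oriented graph of a set of rules `(α, E)`: there is an edge from `β` to `β'` if
`β = β₁ α β₂` for some rule `(α, E)` and `β'` occurs in the expansion of `β₁ E β₂`. -/
def ReductionEdge {r : ℕ} (rules : Set (Biword r × (Biword r →₀ CoeffQ)))
    (β β' : Biword r) : Prop :=
  ∃ p ∈ rules, ∃ β₁ β₂ : Biword r, β = β₁ ++ p.1 ++ β₂ ∧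
    ∃ γ ∈ p.2.support, β' = β₁ ++ γ ++ β₂

/-- A reduction system: a finite set of rules `(α, E)`, with `α` a biword and `E` a finite formal
sum of biwords, such that the first components `α` are distinct and such that all the oriented
paths of the associated graph terminate (the descending chain condition). -/
structure ReductionSystem (r : ℕ) where
  rules : Set (Biword r × (Biword r →₀ CoeffQ))
  finite : rules.Finite
  distinct : ∀ p ∈ rules, ∀ p' ∈ rules, p.1 = p'.1 → p = p'
  dcc : WellFounded fun β' β : Biword r => ReductionEdge rules β β'

namespace ReductionSystem

variable {r : ℕ} (S : ReductionSystem r)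

/-- A biword is irreducible if none of its factors is the first component of a rule. -/
def Irreducible (β : Biword r) : Prop :=
  ∀ p ∈ S.rules, ¬ p.1 <:+: β

/-- `β = β₁ β₂ b β₃` with `β₁ β₂` irreducible, `b` a biletter, and `β₂ b` the first component of
a rule `(β₂ b, E)`: the rule applies at the leftmost possible place. -/
structure LeftmostRedex (β : Biword r) where
  (β₁ β₂ : Biword r)
  b : Biletter r
  β₃ : Biword r
  E : Biword r →₀ CoeffQ
  eq : β = β₁ ++ (β₂ ++ [b]) ++ β₃
  irreducible : S.Irreducible (β₁ ++ β₂)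
  mem : (β₂ ++ [b], E) ∈ S.rules

theorem LeftmostRedex.edge {S : ReductionSystem r} {β : Biword r} (h : S.LeftmostRedex β)
    (γ : h.E.support) : ReductionEdge S.rules β (h.β₁ ++ γ.1 ++ h.β₃) :=
  ⟨_, h.mem, h.β₁, h.β₃, h.eq, γ.1, γ.2, rfl⟩

open Classical in
/-- The leftmost reduction `[β]` of a biword `β`, a finite formal sum of biwords: `[β] = β` if `β`
is irreducible, and otherwise `[β] = [β₁ E β₃] = ∑_γ E(γ) [β₁ γ β₃]`, where `β = β₁ β₂ b β₃` is the
factorization of `β` at its leftmost factor `β₂ b` that is the first component of a rule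
`(β₂ b, E)`. The recursion terminates by the descending chain condition. -/
noncomputable def reduceBiword : Biword r → (Biword r →₀ CoeffQ) :=
  S.dcc.fix fun β reduce =>
    if h : Nonempty (S.LeftmostRedex β) then
      ∑ γ : h.some.E.support, h.some.E γ.1 • reduce (h.some.β₁ ++ γ.1 ++ h.some.β₃) (h.some.edge γ)
    else Finsupp.single β 1

/-- The leftmost reduction `[E]` of a formal sum `E = ∑ c(β) β`, namely `∑ c(β) [β]`. -/
noncomputable def leftmostReduction (E : FormalSum CoeffQ (Biletter r)) :
    FormalSum CoeffQ (Biletter r) :=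
  fun γ => ∑ᶠ β : Biword r, E β * S.reduceBiword β γ

end ReductionSystem

/-! ### The contextual reduction system -/

/-- `V(x, y, a, b) = (a - x - 1/2)(a - y - 1/2)(b - x - 1/2)(b - y - 1/2)`. Replacing the letters
`1, …, r` by `0, …, r - 1` does not change the differences. -/
def contextV {r : ℕ} (x y a b : Fin r) : ℚ :=
  ((a : ℕ) - (x : ℕ) - 1 / 2) * ((a : ℕ) - (y : ℕ) - 1 / 2) *
    (((b : ℕ) - (x : ℕ) - 1 / 2) * ((b : ℕ) - (y : ℕ) - 1 / 2))

/-- For `x > y`: `(xy over ab) = (yx over ab)` if `V(x, y, a, b) > 0`, and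
`(xy over ab) = (yx over ba)` if `V(x, y, a, b) < 0`. -/
def contextualRules (r : ℕ) : Set (Biword r × (Biword r →₀ CoeffQ)) :=
  {p | ∃ x y a b : Fin r, y < x ∧
    ((0 < contextV x y a b ∧
        p = ([(x, a), (y, b)], Finsupp.single [(y, a), (x, b)] 1)) ∨
      (contextV x y a b < 0 ∧
        p = ([(x, a), (y, b)], Finsupp.single [(y, b), (x, a)] 1)))}

theorem contextualRules_finite (r : ℕ) : (contextualRules r).Finite := by
  refine ((Set.finite_range (fun z : (Fin r × Fin r) × (Fin r × Fin r) =>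
      (([(z.1.1, z.2.1), (z.1.2, z.2.2)], Finsupp.single [(z.1.2, z.2.1), (z.1.1, z.2.2)] 1) :
        Biword r × (Biword r →₀ CoeffQ)))).union
    (Set.finite_range (fun z : (Fin r × Fin r) × (Fin r × Fin r) =>
      (([(z.1.1, z.2.1), (z.1.2, z.2.2)], Finsupp.single [(z.1.2, z.2.2), (z.1.1, z.2.1)] 1) :
        Biword r × (Biword r →₀ CoeffQ))))).subset ?_
  rintro p ⟨x, y, a, b, -, ⟨-, rfl⟩ | ⟨-, rfl⟩⟩
  · exact Or.inl ⟨((x, y), (a, b)), rfl⟩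
  · exact Or.inr ⟨((x, y), (a, b)), rfl⟩

theorem contextualRules_distinct (r : ℕ) (p : Biword r × (Biword r →₀ CoeffQ))
    (hp : p ∈ contextualRules r) (p' : Biword r × (Biword r →₀ CoeffQ))
    (hp' : p' ∈ contextualRules r) (h : p.1 = p'.1) : p = p' := by
  obtain ⟨x, y, a, b, -, ⟨hV, rfl⟩ | ⟨hV, rfl⟩⟩ := hp <;>
  obtain ⟨x', y', a', b', -, ⟨hV', rfl⟩ | ⟨hV', rfl⟩⟩ := hp' <;>
  · simp only [List.cons.injEq, Prod.mk.injEq, and_true] at h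
    obtain ⟨⟨rfl, rfl⟩, rfl, rfl⟩ := h
    first | rfl | exact absurd hV (not_lt.2 hV'.le)

theorem wordInv_swap_lt {r : ℕ} {x y : Fin r} (h : y < x) (w₁ w₂ : List (Fin r)) :
    wordInv (w₁ ++ (y :: x :: w₂)) < wordInv (w₁ ++ (x :: y :: w₂)) := by
  induction w₁ with
  | nil => simp [wordInv, h, h.not_gt]; omega
  | cons z w ih => simp only [List.cons_append, wordInv, List.countP_append, List.countP_cons]; omega

theorem contextualRules_dcc (r : ℕ) :
    WellFounded fun β' β : Biword r => ReductionEdge (contextualRules r) β β' := by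
  refine Subrelation.wf (r := InvImage (· < ·) fun β : Biword r => wordInv (β.map Prod.fst)) ?_
    (InvImage.wf _ wellFounded_lt)
  rintro β' β ⟨p, ⟨x, y, a, b, hxy, ⟨-, rfl⟩ | ⟨-, rfl⟩⟩, β₁, β₂, rfl, γ, hγ, rfl⟩ <;>
  · rw [Finsupp.support_single _ one_ne_zero, Finset.mem_singleton] at hγ
    subst hγ
    simpa [InvImage] using wordInv_swap_lt hxy (β₁.map Prod.fst) (β₂.map Prod.fst)

/-- The reduction system of the contextual algebra. -/
def SH (r : ℕ) : ReductionSystem r where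
  rules := contextualRules r
  finite := contextualRules_finite r
  distinct := contextualRules_distinct r
  dcc := contextualRules_dcc r

theorem ReductionSystem.reduceBiword_of_nonempty {r : ℕ} (S : ReductionSystem r) (β : Biword r)
    (h : Nonempty (S.LeftmostRedex β)) :
    S.reduceBiword β = ∑ γ : h.some.E.support,
      h.some.E γ.1 • S.reduceBiword (h.some.β₁ ++ γ.1 ++ h.some.β₃) := by
  rw [reduceBiword, WellFounded.fix_eq, dif_pos h]

theorem ReductionSystem.reduceBiword_of_isEmpty {r : ℕ} (S : ReductionSystem r) (β : Biword r)
    (h : ¬ Nonempty (S.LeftmostRedex β)) :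
    S.reduceBiword β = Finsupp.single β 1 := by
  rw [reduceBiword, WellFounded.fix_eq, dif_neg h]

/-- All the biwords in `[β]` have the length of `β`. -/
theorem SH_reduceBiword_length {r : ℕ} (β : Biword r) :
    ∀ γ, (SH r).reduceBiword β γ ≠ 0 → γ.length = β.length := by
  induction β using (SH r).dcc.induction with
  | _ β ih =>
  intro γ hγ
  by_cases h : Nonempty ((SH r).LeftmostRedex β)
  · rw [ReductionSystem.reduceBiword_of_nonempty _ _ h, Finsupp.finsetSum_apply] at hγ
    obtain ⟨δ, -, hδ⟩ := Finset.exists_ne_zero_of_sum_ne_zero hγ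
    have h1 := ih _ (h.some.edge δ) γ (by intro h0; exact hδ (by rw [Finsupp.smul_apply, h0, smul_zero]))
    rw [h1]
    have hm := h.some.mem
    have he := congrArg List.length h.some.eq
    have hd : δ.1.length = (h.some.β₂ ++ [h.some.b]).length := by
      have h2 : ∀ E, h.some.E = E → δ.1 ∈ E.support := fun E h3 => h3 ▸ δ.2
      obtain ⟨x, y, a, b, -, ⟨-, hp⟩ | ⟨-, hp⟩⟩ := hm <;>
      · rw [Prod.mk.injEq] at hp
        rw [hp.1]
        replace h2 := h2 _ hp.2
        rw [Finsupp.support_single _ one_ne_zero, Finset.mem_singleton] at h2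
        rw [h2]; rfl
    simp only [List.length_append] at he hd ⊢
    omega
  · rw [ReductionSystem.reduceBiword_of_isEmpty _ _ h] at hγ
    rw [Finsupp.single_apply] at hγ
    split_ifs at hγ with h0
    · rw [h0]
    · exact absurd rfl hγ

/-- The sum over `β` in the leftmost reduction has finitely many nonzero terms for `SH r`. -/
theorem SH_finite {r : ℕ} (E : FormalSum CoeffQ (Biletter r)) (γ : Biword r) :
    (Function.support fun β => E β * (SH r).reduceBiword β γ).Finite := by
  refine (List.finite_length_eq (Biletter r) γ.length).subset fun β hβ => ?_
  exact (SH_reduceBiword_length β γ (right_ne_zero_of_mul hβ)).symm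

/-! ### The statistics `exc` and `den` and the weight function -/

/-- The number of exceedances of a biword: the number of biletters whose bottom letter exceeds
the top letter. -/
def exc {r : ℕ} (β : Biword r) : ℕ :=
  β.countP fun b => b.1 < b.2

/-- `c ∈ ⟧a, x⟧`, the cyclic interval, which is `{a + 1, …, x}` if `a ≤ x`, and the complement of
`{x + 1, …, a}` if `x < a`. -/
def InCyclicInterval {r : ℕ} (c a x : Fin r) : Prop :=
  if a ≤ x then a < c ∧ c ≤ x else a < c ∨ c ≤ x

instance {r : ℕ} (c a x : Fin r) : Decidable (InCyclicInterval c a x) := by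
  unfold InCyclicInterval; infer_instance

/-- The Denert statistic of a biword `(x₁ ⋯ xₙ over a₁ ⋯ aₙ)`: the number of pairs `i < j` such that
`aᵢ ∈ ⟧aⱼ, xⱼ⟧`. -/
def den {r : ℕ} : Biword r → ℕ
  | [] => 0
  | b :: β => β.countP (fun b' => InCyclicInterval b.2 b'.2 b'.1) + den β

/-- The linear map `ψ` with `ψ(u over v) = t ^ exc (u over v) q ^ den (u over v) u`. The
coefficient of a word `u` in `ψ(E)` is the finite sum over the biwords `α = (u over v)`. -/
noncomputable def psi {r : ℕ} (E : FormalSum CoeffQ (Biletter r)) : FormalSum CoeffTQ (Fin r) :=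
  fun u => ∑ v : Fin u.length → Fin r,
    let α : Biword r := List.ofFn fun i => (u.get i, v i)
    LaurentPolynomial.C (E α) *
      (LaurentPolynomial.T (exc α) * LaurentPolynomial.C (LaurentPolynomial.T (den α)))

/-! Every rule of (SH) preserves the multiset of top letters, `exc` and `den`, and the irreducible
biwords are those with a non-decreasing top word. Hence the coefficient of `u` on the left vanishes
unless `u` is non-decreasing, and otherwise it is the value on Ferm × Bos of the functional Φ =
`classWeight u` (`psi_leftmostReduction_apply`). Since V is symmetric in a and b, the same kind of
rule governs the bottom words ab and ba, so Φ(xy/ab) + Φ(xy/ba) = Φ(yx/ab) + Φ(yx/ba)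
(`listRightQuantum_classWeight`).

It remains to prove the Master Theorem for every functional with this property
(`ListRightQuantum.sum_fermBosSum`). For words of length n put χ(g) = ∑_u Φ(u∘g over u). The part of
Ferm × Bos with k fermionic letters is, up to sign and the factor k!(n-k)!, the value H(S, T) of χ
on the symmetrizer of the last n-k positions T times the antisymmetrizer of the first k positions S
(`ListRightQuantum.hookSum_eq`). Adding j ∈ T to S, or i ∈ S to T, produces transposition terms of
opposite signs, whence |T| H(S ∪ {j}, T) + |S| H(S, T ∪ {i}) = n H(S, T) (`hookSum_insert_eq`). This
is the analogue of e_k h_{n-k} being the sum of two hook Schur functions: neighbouring values of k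
share a hook, and the alternating sum telescopes. -/

/-! ### Hook sums over the symmetric group -/

/-- The permutations that fix every element outside of `S`. -/
def permsOn {α : Type*} [Fintype α] [DecidableEq α] (S : Finset α) : Finset (Equiv.Perm α) :=
  Finset.univ.filter fun σ => ∀ x, x ∉ S → σ x = x

section HookSum

open Equiv Finset

variable {α R : Type*} [Fintype α] [DecidableEq α] [CommRing R]

theorem mem_permsOn {S : Finset α} {σ : Perm α} : σ ∈ permsOn S ↔ ∀ x, x ∉ S → σ x = x := by
  simp [permsOn]

theorem mul_mem_permsOn {S : Finset α} {σ τ : Perm α} (hσ : σ ∈ permsOn S) (hτ : τ ∈ permsOn S) :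
    σ * τ ∈ permsOn S := by
  rw [mem_permsOn] at *
  intro x hx
  rw [Perm.mul_apply, hτ x hx, hσ x hx]

theorem inv_mem_permsOn {S : Finset α} {σ : Perm α} (hσ : σ ∈ permsOn S) :
    σ⁻¹ ∈ permsOn S := by
  rw [mem_permsOn] at *
  intro x hx
  rw [Perm.inv_eq_iff_eq, hσ x hx]

theorem swap_mem_permsOn {S : Finset α} {i j : α} (hi : i ∈ S) (hj : j ∈ S) :
    swap i j ∈ permsOn S := by
  rw [mem_permsOn]
  intro x hx
  exact swap_apply_of_ne_of_ne (by rintro rfl; exact hx hi) (by rintro rfl; exact hx hj)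

theorem sum_permsOn_mul_left {M : Type*} [AddCommMonoid M] {S : Finset α} {τ : Perm α}
    (hτ : τ ∈ permsOn S) (f : Perm α → M) :
    ∑ σ ∈ permsOn S, f (τ * σ) = ∑ σ ∈ permsOn S, f σ :=
  Finset.sum_bij' (fun σ _ => τ * σ) (fun σ _ => τ⁻¹ * σ)
    (fun _ h => mul_mem_permsOn hτ h) (fun _ h => mul_mem_permsOn (inv_mem_permsOn hτ) h)
    (by simp) (by simp) (by simp)

theorem sum_permsOn_inv {M : Type*} [AddCommMonoid M] (S : Finset α) (f : Perm α → M) :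
    ∑ σ ∈ permsOn S, f σ⁻¹ = ∑ σ ∈ permsOn S, f σ :=
  Finset.sum_bij' (fun σ _ => σ⁻¹) (fun σ _ => σ⁻¹)
    (fun _ h => inv_mem_permsOn h) (fun _ h => inv_mem_permsOn h)
    (by simp) (by simp) (by simp)

theorem sum_permsOn_mul_right {M : Type*} [AddCommMonoid M] {S : Finset α} {τ : Perm α}
    (hτ : τ ∈ permsOn S) (f : Perm α → M) :
    ∑ σ ∈ permsOn S, f (σ * τ) = ∑ σ ∈ permsOn S, f σ :=
  Finset.sum_bij' (fun σ _ => σ * τ) (fun σ _ => σ * τ⁻¹)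
    (fun _ h => mul_mem_permsOn h hτ) (fun _ h => mul_mem_permsOn h (inv_mem_permsOn hτ))
    (by simp) (by simp) (by simp)

/-- Coset decomposition: a permutation τ of `insert a S` is uniquely `swap a b * σ` with b = τ a and
σ fixing a. -/
theorem sum_permsOn_insert {M : Type*} [AddCommMonoid M] {S : Finset α} {a : α} (ha : a ∉ S)
    (f : Perm α → M) :
    ∑ σ ∈ permsOn (insert a S), f σ = ∑ b ∈ insert a S, ∑ σ ∈ permsOn S, f (swap a b * σ) := by
  rw [← Finset.sum_product']
  symm
  refine Finset.sum_bij' (fun p _ => swap a p.1 * p.2) (fun τ _ => (τ a, swap a (τ a) * τ))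
    ?_ ?_ ?_ ?_ ?_
  · rintro ⟨b, σ⟩ h
    rw [Finset.mem_product] at h
    refine mul_mem_permsOn (swap_mem_permsOn (Finset.mem_insert_self _ _) h.1) ?_
    exact mem_permsOn.2 fun x hx => mem_permsOn.1 h.2 x fun h' => hx (Finset.mem_insert_of_mem h')
  · intro τ h
    rw [mem_permsOn] at h
    rw [Finset.mem_product]
    constructor
    · by_contra h'
      have := h _ h'
      rw [τ.injective this] at h'
      exact h' (Finset.mem_insert_self _ _)
    · rw [mem_permsOn]
      intro x hx
      by_cases hxa : x = a
      · simp [hxa]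
      · have hx' : x ∉ insert a S := by simp [hxa, hx]
        rw [Perm.mul_apply, h x hx']
        refine swap_apply_of_ne_of_ne hxa fun h' => hxa ?_
        rw [← h x hx'] at h'
        exact τ.injective h'
  · rintro ⟨b, σ⟩ h
    rw [Finset.mem_product] at h
    have := mem_permsOn.1 h.2 a ha
    simp [this]
  · intro τ h
    simp
  · intro p h
    rfl

theorem sum_permsOn_insert' {M : Type*} [AddCommMonoid M] {S : Finset α} {a : α} (ha : a ∉ S)
    (f : Perm α → M) :
    ∑ σ ∈ permsOn (insert a S), f σ = ∑ b ∈ insert a S, ∑ σ ∈ permsOn S, f (σ * swap a b) := by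
  rw [← sum_permsOn_inv, sum_permsOn_insert ha]
  refine Finset.sum_congr rfl fun b _ => ?_
  rw [← sum_permsOn_inv]
  simp

theorem commute_of_mem_permsOn {S T : Finset α} (h : Disjoint S T) {σ τ : Perm α}
    (hσ : σ ∈ permsOn S) (hτ : τ ∈ permsOn T) : τ * σ = σ * τ := by
  refine (Perm.Disjoint.commute fun x => ?_).eq
  by_cases hx : x ∈ T
  · exact Or.inr (mem_permsOn.1 hσ x fun h' => Finset.disjoint_left.1 h h' hx)
  · exact Or.inl (mem_permsOn.1 hτ x hx)

/-- The value of `χ` on the product of the symmetrizer of `T` and the antisymmetrizer of `S`. -/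
def hookSum (χ : Perm α → R) (S T : Finset α) : R :=
  ∑ b ∈ permsOn T, ∑ a ∈ permsOn S, ((Perm.sign a : ℤ) : R) * χ (b * a)

/-- `χ` changes its sign on the left of an antisymmetrizer of `S`. -/
def LeftAlternating (χ : Perm α → R) (S : Finset α) : Prop :=
  ∀ i ∈ S, ∀ j ∈ S, i ≠ j → ∀ g, ∑ a ∈ permsOn S, ((Perm.sign a : ℤ) : R) * χ (swap i j * g * a) =
    -∑ a ∈ permsOn S, ((Perm.sign a : ℤ) : R) * χ (g * a)

/-- `χ` is invariant on the right of a symmetrizer of `T`. -/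
def RightInvariant (χ : Perm α → R) (T : Finset α) : Prop :=
  ∀ i ∈ T, ∀ j ∈ T, ∀ g, ∑ b ∈ permsOn T, χ (b * g * swap i j) = ∑ b ∈ permsOn T, χ (b * g)

/-- The value of `χ` on the product of the symmetrizer of `T`, the transposition of `i` and `j`,
and the antisymmetrizer of `S`. -/
def hookSwapSum (χ : Perm α → R) (S T : Finset α) (i j : α) : R :=
  ∑ b ∈ permsOn T, ∑ a ∈ permsOn S, ((Perm.sign a : ℤ) : R) * χ (b * swap i j * a)

variable {χ : Perm α → R} {S T : Finset α}

/-- Conjugating (i j) by p = (i i') gives (i' j). The left p commutes past the symmetrizer of T and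
costs a sign by `LeftAlternating`; the right p is absorbed by the antisymmetrizer with a second
sign. -/
theorem hookSwapSum_left_eq (hST : Disjoint S T) (hL : LeftAlternating χ S) {i i' j : α}
    (hi : i ∈ S) (hi' : i' ∈ S) (hj : j ∈ T) :
    hookSwapSum χ S T i' j = hookSwapSum χ S T i j := by
  by_cases h : i = i'
  · rw [h]
  refine Finset.sum_congr rfl fun b hb => ?_
  have hp := swap_mem_permsOn hi hi'
  have hji : j ≠ i := by rintro rfl; exact Finset.disjoint_left.1 hST hi hj
  have hji' : j ≠ i' := by rintro rfl; exact Finset.disjoint_left.1 hST hi' hj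
  have hs : swap i' j = swap i i' * swap i j * swap i i' := by
    rw [swap_comm i j]
    exact (swap_mul_swap_mul_swap hji hji').symm
  have h1 := hL i hi i' hi' h (b * swap i j * swap i i')
  have h2 := sum_permsOn_mul_left hp
    (fun a => ((Perm.sign a : ℤ) : R) * χ (b * swap i j * a))
  simp only [Perm.sign_mul, Perm.sign_swap h, ← mul_assoc] at h2
  simp only [Units.val_neg, neg_mul, one_mul, Int.cast_neg,
    Finset.sum_neg_distrib] at h2
  rw [← h2, ← h1]
  refine Finset.sum_congr rfl fun a _ => ?_
  rw [hs]
  simp only [← mul_assoc]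
  rw [commute_of_mem_permsOn hST hp hb]

/-- Mirror image: the conjugating transposition (j j') is absorbed on the left by the symmetrizer of
T, and on the right it commutes past the antisymmetrizer of S and disappears by `RightInvariant`. -/
theorem hookSwapSum_right_eq (hST : Disjoint S T) (hR : RightInvariant χ T) {i j j' : α}
    (hi : i ∈ S) (hj : j ∈ T) (hj' : j' ∈ T) :
    hookSwapSum χ S T i j' = hookSwapSum χ S T i j := by
  by_cases h : j = j'
  · rw [h]
  unfold hookSwapSum
  rw [Finset.sum_comm, Finset.sum_comm (s := permsOn T)]
  refine Finset.sum_congr rfl fun a ha => ?_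
  have hp := swap_mem_permsOn hj hj'
  have hij : i ≠ j := by rintro rfl; exact Finset.disjoint_left.1 hST hi hj
  have hij' : i ≠ j' := by rintro rfl; exact Finset.disjoint_left.1 hST hi hj'
  have hs : swap i j' = swap j j' * swap i j * swap j j' := by
    rw [swap_comm i j']
    exact (swap_mul_swap_mul_swap hij hij').symm
  rw [← Finset.mul_sum, ← Finset.mul_sum]
  congr 1
  have h1 := hR j hj j' hj' (swap i j * a)
  simp only [← mul_assoc] at h1
  rw [← h1, ← sum_permsOn_mul_right hp]
  refine Finset.sum_congr rfl fun b _ => ?_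
  rw [hs]
  simp only [mul_assoc]
  rw [swap_mul_self_mul, commute_of_mem_permsOn hST ha hp]

/-- The antisymmetrizer of S ∪ {j} is (1 - ∑ (i j)) times that of S. Here j may lie in T; this
overlap of the two sets is what makes a hook. -/
theorem hookSum_insert_left {j : α} (hj : j ∉ S) :
    hookSum χ (insert j S) T = hookSum χ S T - ∑ i ∈ S, hookSwapSum χ S T i j := by
  unfold hookSwapSum hookSum
  rw [Finset.sum_comm (s := S), ← Finset.sum_sub_distrib]
  refine Finset.sum_congr rfl fun b _ => ?_
  rw [sum_permsOn_insert hj, Finset.sum_insert hj, sub_eq_add_neg, ← Finset.sum_neg_distrib]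
  congr 1
  · rw [show swap j j = 1 from swap_self j]
    simp
  · refine Finset.sum_congr rfl fun i hi => ?_
    rw [← Finset.sum_neg_distrib]
    refine Finset.sum_congr rfl fun a _ => ?_
    have : j ≠ i := by rintro rfl; exact hj hi
    rw [Perm.sign_mul, Perm.sign_swap this, swap_comm j i, mul_assoc]
    simp

theorem hookSum_insert_right {i : α} (hi : i ∉ T) :
    hookSum χ S (insert i T) = hookSum χ S T + ∑ j ∈ T, hookSwapSum χ S T i j := by
  unfold hookSwapSum hookSum
  rw [sum_permsOn_insert' hi, Finset.sum_insert hi, show swap i i = 1 from swap_self i]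
  simp

/-- All the transposition terms are equal, so the two expansions contain |S| and |T| copies of one
value with opposite signs; the weights |T| and |S| cancel them. -/
theorem hookSum_insert_eq (hST : Disjoint S T) (hL : LeftAlternating χ S)
    (hR : RightInvariant χ T) {i j : α} (hi : i ∈ S) (hj : j ∈ T) :
    (T.card : R) * hookSum χ (insert j S) T + (S.card : R) * hookSum χ S (insert i T) =
      ((S.card + T.card : ℕ) : R) * hookSum χ S T := by
  rw [hookSum_insert_left (Finset.disjoint_right.1 hST hj),
    hookSum_insert_right (Finset.disjoint_left.1 hST hi),
    Finset.sum_congr rfl fun i' hi' => hookSwapSum_left_eq hST hL hi hi' hj,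
    Finset.sum_congr rfl fun j' hj' => hookSwapSum_right_eq hST hR hi hj hj']
  simp only [Finset.sum_const, nsmul_eq_mul]
  push_cast
  ring

end HookSum

/-! ### Hook sums for initial and final segments, and their telescoping -/

section FinHookSum

open Equiv Finset

variable {R : Type*} [CommRing R] {n : ℕ}

/-- The first `k` elements of `Fin n`. -/
def firstFin (n k : ℕ) : Finset (Fin n) := Finset.univ.filter fun i => (i : ℕ) < k

/-- The elements of `Fin n` from the `k`-th on. -/
def lastFin (n k : ℕ) : Finset (Fin n) := Finset.univ.filter fun i => k ≤ (i : ℕ)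

theorem mem_firstFin {k : ℕ} {i : Fin n} : i ∈ firstFin n k ↔ (i : ℕ) < k := by simp [firstFin]

theorem mem_lastFin {k : ℕ} {i : Fin n} : i ∈ lastFin n k ↔ k ≤ (i : ℕ) := by simp [lastFin]

theorem insert_firstFin {k : ℕ} (hk : k < n) :
    insert (⟨k, hk⟩ : Fin n) (firstFin n k) = firstFin n (k + 1) := by
  ext i; simp only [Finset.mem_insert, mem_firstFin, Fin.ext_iff]; omega

theorem insert_lastFin {k : ℕ} (hk : k < n) :
    insert (⟨k, hk⟩ : Fin n) (lastFin n (k + 1)) = lastFin n k := by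
  ext i; simp only [Finset.mem_insert, mem_lastFin, Fin.ext_iff]; omega

theorem disjoint_firstFin_lastFin (k : ℕ) : Disjoint (firstFin n k) (lastFin n k) := by
  rw [Finset.disjoint_left]
  intro i hi
  rw [mem_firstFin] at hi
  rw [mem_lastFin]
  omega

theorem card_firstFin {k : ℕ} (hk : k ≤ n) : (firstFin n k).card = k := by
  simpa [firstFin, hk] using Fin.card_filter_val_lt (n := n) (m := k)

theorem card_lastFin {k : ℕ} (hk : k ≤ n) : (lastFin n k).card = n - k := by
  have h : lastFin n k = (firstFin n k)ᶜ := by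
    ext i; simp [mem_lastFin, mem_firstFin]
  rw [h, Finset.card_compl, card_firstFin hk, Fintype.card_fin]

theorem card_mul_hookSum {χ : Perm (Fin n) → R}
    (hL : ∀ k, LeftAlternating χ (firstFin n k)) (hR : ∀ k, RightInvariant χ (lastFin n k))
    {k : ℕ} (hk : k ≤ n) :
    (n : R) * hookSum χ (firstFin n k) (lastFin n k) =
      ((n - k : ℕ) : R) * hookSum χ (firstFin n (k + 1)) (lastFin n k) +
        (k : R) * hookSum χ (firstFin n k) (lastFin n (k - 1)) := by
  -- For k = n or k = 0 one block is empty and one of the two coefficients vanishes, so the values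
  -- of `firstFin n (n + 1)` and of the truncated 0 - 1 are irrelevant.
  rcases hk.eq_or_lt with rfl | hk'
  · rcases k with _ | m
    · simp
    · have hT : lastFin (m + 1) (m + 1) = ∅ := by
        rw [← Finset.card_eq_zero, card_lastFin le_rfl, Nat.sub_self]
      rw [Nat.add_sub_cancel, ← insert_lastFin (Nat.lt_succ_self m),
        hookSum_insert_right (by simp [mem_lastFin]), hT]
      simp
  · rcases k with _ | m
    · have hS : firstFin n 0 = ∅ := by simp [firstFin]
      rw [← insert_firstFin hk', hookSum_insert_left (by simp [mem_firstFin]), hS]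
      simp
    · have := hookSum_insert_eq (disjoint_firstFin_lastFin (n := n) (m + 1)) (hL _) (hR _)
        (i := ⟨m, by omega⟩) (j := ⟨m + 1, hk'⟩) (by simp [mem_firstFin]) (by simp [mem_lastFin])
      rw [insert_firstFin, insert_lastFin, card_firstFin hk, card_lastFin hk,
        Nat.add_sub_cancel' hk] at this
      rw [Nat.add_sub_cancel, this]

/-- The alternating sum of the hook sums vanishes. -/
theorem sum_choose_mul_hookSum {χ : Perm (Fin n) → R}
    (hL : ∀ k, LeftAlternating χ (firstFin n k)) (hR : ∀ k, RightInvariant χ (lastFin n k)) :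
    ∑ k ∈ Finset.range (n + 1), (-1) ^ k * (n.choose k : R) *
      ((n : R) * hookSum χ (firstFin n k) (lastFin n k)) = 0 := by
  -- Closed form of the partial sums: only the last hook survives. Its coefficient contains n - m,
  -- which is 0 at m = n.
  have key : ∀ m ≤ n, ∑ k ∈ Finset.range (m + 1), (-1) ^ k * (n.choose k : R) *
      ((n : R) * hookSum χ (firstFin n k) (lastFin n k)) =
      (-1) ^ m * (n.choose m : R) * ((n - m : ℕ) : R) *
        hookSum χ (firstFin n (m + 1)) (lastFin n m) := by
    intro m hm
    induction m with
    | zero =>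
      rw [Finset.sum_range_one, card_mul_hookSum hL hR (Nat.zero_le n)]
      simp
    | succ m ih =>
      rw [Finset.sum_range_succ, ih (by omega), card_mul_hookSum hL hR hm, Nat.add_sub_cancel]
      have h : (n.choose (m + 1) : R) * ((m + 1 : ℕ) : R) = n.choose m * ((n - m : ℕ) : R) := by
        exact_mod_cast congrArg (Nat.cast (R := R)) (Nat.choose_succ_right_eq n m)
      rw [pow_succ]
      linear_combination (-(-1) ^ m * hookSum χ (firstFin n (m + 1)) (lastFin n m)) * h
  rw [key n le_rfl]
  simp

end FinHookSum

/-! ### The quantum MacMahon Master Theorem for right quantum functions -/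

section RightQuantum

open Equiv Finset

variable {n : ℕ} {A R : Type*} [CommRing R]

/-- A function of two words (the top and the bottom word of a biword) is right quantum if its
symmetrization in two neighbouring bottom letters is symmetric in the two top letters. -/
def RightQuantum (Ψ : (Fin n → A) → (Fin n → A) → R) : Prop :=
  ∀ i j : Fin n, (i : ℕ) + 1 = j → ∀ u v, Ψ u v + Ψ u (v ∘ swap i j) =
    Ψ (u ∘ swap i j) v + Ψ (u ∘ swap i j) (v ∘ swap i j)

/-- A transposition of two points of an interval is obtained from neighbouring ones by repeated
conjugation; order-connectedness keeps the intermediate points in S. -/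
theorem swap_induction_of_ordConnected {S : Finset (Fin n)} (hS : (S : Set (Fin n)).OrdConnected)
    {P : Perm (Fin n) → Prop} (h1 : P 1) (hmul : ∀ σ τ, P σ → P τ → P (σ * τ))
    (hadj : ∀ i ∈ S, ∀ j ∈ S, (i : ℕ) + 1 = j → P (swap i j)) {i j : Fin n} (hi : i ∈ S)
    (hj : j ∈ S) : P (swap i j) := by
  have key : ∀ d : ℕ, ∀ i ∈ S, ∀ j ∈ S, (i : ℕ) + 1 + d = j → P (swap i j) := by
    intro d
    induction d with
    | zero => intro i hi j hj h; exact hadj i hi j hj h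
    | succ d ih =>
      intro i hi j hj h
      have hl : (i : ℕ) + 1 + d < n := by omega
      have hlS : (⟨(i : ℕ) + 1 + d, hl⟩ : Fin n) ∈ S :=
        hS.out hi hj ⟨by rw [Fin.le_def]; simp; omega, by rw [Fin.le_def]; simp; omega⟩
      have h2 := hadj _ hlS j hj (by simpa [add_assoc] using h)
      have h3 := hmul _ _ (hmul _ _ h2 (ih i hi _ hlS rfl)) h2
      rw [swap_mul_swap_mul_swap] at h3
      · rwa [swap_comm]
      · intro h; have := Fin.ext_iff.1 h; dsimp only at this; omega
      · intro h; have := Fin.ext_iff.1 h; omega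
  rcases lt_trichotomy i j with h | rfl | h
  · exact key (j - i - 1) i hi j hj (by rw [Fin.lt_def] at h; omega)
  · rwa [show swap i i = 1 from swap_self i]
  · rw [swap_comm]
    exact key (i - j - 1) j hj i hi (by rw [Fin.lt_def] at h; omega)

variable {Ψ : (Fin n → A) → (Fin n → A) → R}

section TwoTorsionFree

variable [IsDomain R] [CharZero R]

/-- Summed over the symmetrizer of the bottom word, the two terms on each side of the relation
coincide. This gives twice the claim for neighbouring positions. -/
theorem RightQuantum.sum_comp_swap (hΨ : RightQuantum Ψ) {S : Finset (Fin n)}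
    (hS : (S : Set (Fin n)).OrdConnected) {i j : Fin n} (hi : i ∈ S) (hj : j ∈ S)
    (u v : Fin n → A) :
    ∑ b ∈ permsOn S, Ψ (u ∘ swap i j) (v ∘ b) = ∑ b ∈ permsOn S, Ψ u (v ∘ b) := by
  refine swap_induction_of_ordConnected hS
    (P := fun σ => ∀ u, ∑ b ∈ permsOn S, Ψ (u ∘ σ) (v ∘ b) = ∑ b ∈ permsOn S, Ψ u (v ∘ b))
    (fun u => by simp) (fun σ τ hσ hτ u => ?_) (fun i hi j hj hij u => ?_) hi hj u
  · rw [← hσ u, ← hτ (u ∘ σ)]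
    rfl
  · have hs := swap_mem_permsOn hi hj
    have h1 := sum_permsOn_mul_right hs (fun b => Ψ u (v ∘ b))
    have h2 := sum_permsOn_mul_right hs (fun b => Ψ (u ∘ swap i j) (v ∘ b))
    have h3 := Finset.sum_congr (rfl : permsOn S = permsOn S)
      fun b _ => hΨ i j hij u (v ∘ b)
    simp only [Finset.sum_add_distrib] at h3
    simp only [Perm.coe_mul, ← Function.comp_assoc] at h1 h2
    rw [h1, h2] at h3
    have h4 : (2 : R) ≠ 0 := two_ne_zero
    apply mul_left_cancel₀ h4
    linear_combination -h3

/-- Antisymmetrizing the relation in the top word makes its right side the negative of its left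
side, so both vanish after division by 2. -/
theorem RightQuantum.alternating_sum_comp_swap (hΨ : RightQuantum Ψ) {S : Finset (Fin n)}
    (hS : (S : Set (Fin n)).OrdConnected) {i j : Fin n} (hi : i ∈ S) (hj : j ∈ S)
    (u v : Fin n → A) :
    ∑ a ∈ permsOn S, ((Perm.sign a : ℤ) : R) * Ψ (u ∘ a) (v ∘ swap i j) =
      ((Perm.sign (swap i j) : ℤ) : R) *
        ∑ a ∈ permsOn S, ((Perm.sign a : ℤ) : R) * Ψ (u ∘ a) v := by
  refine swap_induction_of_ordConnected hS
    (P := fun σ => ∀ v, ∑ a ∈ permsOn S, ((Perm.sign a : ℤ) : R) * Ψ (u ∘ a) (v ∘ σ) =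
      ((Perm.sign σ : ℤ) : R) * ∑ a ∈ permsOn S, ((Perm.sign a : ℤ) : R) * Ψ (u ∘ a) v)
    (fun v => by simp) (fun σ τ hσ hτ v => ?_) (fun i hi j hj hij v => ?_) hi hj v
  · rw [Perm.coe_mul, ← Function.comp_assoc, hτ, hσ, Perm.sign_mul]
    push_cast
    ring
  · have hs := swap_mem_permsOn hi hj
    have hne : i ≠ j := by rintro rfl; omega
    have h1 := sum_permsOn_mul_right hs (fun a => ((Perm.sign a : ℤ) : R) * Ψ (u ∘ a) v)
    have h2 := sum_permsOn_mul_right hs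
      (fun a => ((Perm.sign a : ℤ) : R) * Ψ (u ∘ a) (v ∘ swap i j))
    have h3 := Finset.sum_congr (rfl : permsOn S = permsOn S)
      fun a _ => congrArg (((Perm.sign a : ℤ) : R) * ·) (hΨ i j hij (u ∘ a) v)
    simp only [mul_add, Finset.sum_add_distrib] at h3
    simp only [Perm.coe_mul, ← Function.comp_assoc, Perm.sign_mul, Perm.sign_swap hne, mul_neg,
      mul_one, Units.val_neg, Int.cast_neg, neg_mul, Finset.sum_neg_distrib] at h1 h2
    rw [← neg_eq_iff_eq_neg.2 h1.symm, ← neg_eq_iff_eq_neg.2 h2.symm] at h3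
    have h4 : (2 : R) ≠ 0 := two_ne_zero
    apply mul_left_cancel₀ h4
    rw [Perm.sign_swap hne]
    simp only [Units.val_neg, Units.val_one, Int.cast_neg, Int.cast_one]
    linear_combination h3

theorem permsOn_univ {α : Type*} [Fintype α] [DecidableEq α] :
    permsOn (Finset.univ : Finset α) = Finset.univ := by
  ext; simp [permsOn]

theorem RightQuantum.sum_comp (hΨ : RightQuantum Ψ) (σ : Perm (Fin n)) (u v : Fin n → A) :
    ∑ b : Perm (Fin n), Ψ (u ∘ σ) (v ∘ b) = ∑ b : Perm (Fin n), Ψ u (v ∘ b) := by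
  induction σ using Perm.swap_induction_on generalizing u with
  | one => simp
  | swap_mul f x y hxy ih =>
    have h := hΨ.sum_comp_swap (S := Finset.univ) (by simpa using Set.ordConnected_univ)
      (Finset.mem_univ x) (Finset.mem_univ y) u v
    rw [permsOn_univ] at h
    rw [← h, ← ih (u ∘ swap x y)]
    rfl

theorem RightQuantum.alternating_sum_comp (hΨ : RightQuantum Ψ) (σ : Perm (Fin n))
    (u v : Fin n → A) :
    ∑ a : Perm (Fin n), ((Perm.sign a : ℤ) : R) * Ψ (u ∘ a) (v ∘ σ) =
      ((Perm.sign σ : ℤ) : R) * ∑ a : Perm (Fin n), ((Perm.sign a : ℤ) : R) * Ψ (u ∘ a) v := by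
  induction σ using Perm.swap_induction_on generalizing v with
  | one => simp
  | swap_mul f x y hxy ih =>
    have h := hΨ.alternating_sum_comp_swap (S := Finset.univ)
      (by simpa using Set.ordConnected_univ) (Finset.mem_univ x) (Finset.mem_univ y) u v
    rw [permsOn_univ] at h
    rw [Perm.coe_mul, ← Function.comp_assoc, ih, h, Perm.sign_mul]
    push_cast
    ring

theorem alternating_sum_eq_zero {u : Fin n → A} (hu : ¬ Function.Injective u) (v : Fin n → A) :
    ∑ a : Perm (Fin n), ((Perm.sign a : ℤ) : R) * Ψ (u ∘ a) v = 0 := by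
  simp only [Function.Injective, not_forall] at hu
  obtain ⟨i, j, huij, hij⟩ := hu
  have h1 := Equiv.sum_comp (Equiv.mulLeft (swap i j))
    (fun a : Perm (Fin n) => ((Perm.sign a : ℤ) : R) * Ψ (u ∘ a) v)
  have h2 : u ∘ swap i j = u := by
    ext l
    by_cases hl : l = i
    · subst hl; simp [huij]
    · by_cases hl' : l = j
      · subst hl'; simp [huij]
      · simp [swap_apply_of_ne_of_ne hl hl']
  simp only [Equiv.coe_mulLeft, Perm.coe_mul, ← Function.comp_assoc, h2, Perm.sign_mul,
    Perm.sign_swap hij] at h1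
  simp only [Units.val_neg, Int.cast_neg, neg_mul, one_mul, Finset.sum_neg_distrib] at h1
  have h4 : (2 : R) ≠ 0 := two_ne_zero
  apply mul_left_cancel₀ h4
  linear_combination -h1

end TwoTorsionFree

/-! ### Twisted traces -/

section Words

variable [Fintype A]

theorem sum_comp_perm {m : ℕ} {M : Type*} [AddCommMonoid M] (σ : Perm (Fin m))
    (f : (Fin m → A) → M) : ∑ u : Fin m → A, f (u ∘ σ) = ∑ u : Fin m → A, f u :=
  (Equiv.arrowCongr σ.symm (Equiv.refl A)).sum_comp f

/-- The trace of `Ψ` twisted by a permutation of the positions. -/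
def twistedTrace (Ψ : (Fin n → A) → (Fin n → A) → R) (g : Perm (Fin n)) : R :=
  ∑ u : Fin n → A, Ψ (u ∘ g) u

/-- The trace runs over all u, so replacing u by u ∘ (i j) moves the transposition from the left of
g to the bottom word, where antisymmetry of the top turns it into a sign. -/
theorem RightQuantum.leftAlternating [IsDomain R] [CharZero R] (hΨ : RightQuantum Ψ)
    {S : Finset (Fin n)} (hS : (S : Set (Fin n)).OrdConnected) :
    LeftAlternating (twistedTrace Ψ) S := by
  intro i hi j hj hij g
  simp only [twistedTrace, Finset.mul_sum]
  rw [Finset.sum_comm, Finset.sum_comm (s := permsOn S), ← sum_comp_perm (swap i j),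
    ← Finset.sum_neg_distrib]
  refine Finset.sum_congr rfl fun u _ => ?_
  have h := hΨ.alternating_sum_comp_swap hS hi hj (u ∘ g) u
  rw [Perm.sign_swap hij] at h
  simp only [Units.val_neg, Units.val_one, Int.cast_neg, Int.cast_one, neg_mul, one_mul] at h
  simp only [Perm.coe_mul, ← Function.comp_assoc]
  rw [← h]
  refine Finset.sum_congr rfl fun a _ => ?_
  rw [Function.comp_assoc u, ← Perm.coe_mul, swap_mul_self]
  rfl

theorem RightQuantum.rightInvariant [IsDomain R] [CharZero R] (hΨ : RightQuantum Ψ)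
    {S : Finset (Fin n)} (hS : (S : Set (Fin n)).OrdConnected) :
    RightInvariant (twistedTrace Ψ) S := by
  intro i hi j hj g
  have key : ∀ g : Perm (Fin n), ∑ b ∈ permsOn S, twistedTrace Ψ (b * g) =
      ∑ u : Fin n → A, ∑ b ∈ permsOn S, Ψ (u ∘ g) (u ∘ b) := by
    intro g
    rw [Finset.sum_comm, ← sum_permsOn_inv]
    refine Finset.sum_congr rfl fun b _ => ?_
    rw [twistedTrace, ← sum_comp_perm b]
    refine Finset.sum_congr rfl fun u _ => ?_
    rw [Function.comp_assoc, ← Perm.coe_mul, mul_inv_cancel_left]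
  simp only [mul_assoc]
  rw [key, key]
  refine Finset.sum_congr rfl fun u _ => ?_
  rw [Perm.coe_mul, ← Function.comp_assoc, hΨ.sum_comp_swap hS hi hj]

theorem sum_permsOn_filter {α β M : Type*} [Fintype α] [DecidableEq α] [Fintype β] [DecidableEq β]
    [AddCommMonoid M] {p : α → Prop} [DecidablePred p] (e : β ≃ Subtype p) (f : Perm α → M) :
    ∑ σ ∈ permsOn (Finset.univ.filter p), f σ = ∑ a : Perm β, f (a.extendDomain e) := by
  rw [Finset.sum_subtype (p := fun σ : Perm α => ∀ x, ¬ p x → σ x = x) _ (by simp [permsOn]),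
    ← (e.permCongr.trans (Perm.subtypeEquivSubtypePerm p)).sum_comp]
  rfl

end Words

/-! ### From all words to sorted representatives -/

section SortedWords

variable [Fintype A] [LinearOrder A] [IsDomain R] [CharZero R]

/-- With the symmetrizer moved to the bottom, the top word may be sorted. As w and w ∘ b have the
same sorted form, each of the n! permutations b contributes the same bosonic sum. -/
theorem RightQuantum.sum_symmetrizer (hΨ : RightQuantum Ψ) :
    ∑ w : Fin n → A, ∑ b : Perm (Fin n), Ψ (w ∘ b) w =
      (n.factorial : R) * ∑ w : Fin n → A, Ψ (w ∘ Tuple.sort w) w := by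
  have h1 : ∑ w : Fin n → A, ∑ b : Perm (Fin n), Ψ (w ∘ b) w =
      ∑ w : Fin n → A, ∑ b : Perm (Fin n), Ψ w (w ∘ b) := by
    rw [Finset.sum_comm, Finset.sum_comm (s := (Finset.univ : Finset (Fin n → A))),
      ← Equiv.sum_comp (Equiv.inv (Perm (Fin n)))]
    refine Finset.sum_congr rfl fun b _ => ?_
    rw [← sum_comp_perm b]
    refine Finset.sum_congr rfl fun w _ => ?_
    rw [Function.comp_assoc, ← Perm.coe_mul]
    simp
  have h2 : ∑ w : Fin n → A, ∑ b : Perm (Fin n), Ψ (w ∘ Tuple.sort w) (w ∘ b) =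
      (n.factorial : R) * ∑ w : Fin n → A, Ψ (w ∘ Tuple.sort w) w := by
    rw [Finset.sum_comm]
    have : ∀ b : Perm (Fin n), ∑ w : Fin n → A, Ψ (w ∘ Tuple.sort w) (w ∘ b) =
        ∑ w : Fin n → A, Ψ (w ∘ Tuple.sort w) w := by
      intro b
      rw [← sum_comp_perm b (fun w => Ψ (w ∘ Tuple.sort w) w)]
      refine Finset.sum_congr rfl fun w _ => ?_
      rw [Tuple.comp_perm_comp_sort_eq_comp_sort]
    rw [Finset.sum_congr rfl fun b _ => this b, Finset.sum_const, Finset.card_univ,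
      Fintype.card_perm, Fintype.card_fin, nsmul_eq_mul]
  rw [h1, ← h2]
  exact Finset.sum_congr rfl fun w _ => (hΨ.sum_comp _ _ _).symm

theorem sum_injective_eq {M : Type*} [AddCommMonoid M] (F : (Fin n → A) → M) :
    ∑ u : Fin n → A with Function.Injective u, F u =
      ∑ u : Fin n → A with StrictMono u, ∑ τ : Perm (Fin n), F (u ∘ τ) := by
  rw [← Finset.sum_product']
  symm
  refine Finset.sum_bij' (fun p _ => p.1 ∘ p.2) (fun u _ => (u ∘ Tuple.sort u, (Tuple.sort u)⁻¹))
    ?_ ?_ ?_ ?_ ?_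
  · rintro ⟨u, τ⟩ h
    simp only [Finset.mem_product, Finset.mem_filter, Finset.mem_univ, true_and, and_true] at h ⊢
    exact h.injective.comp τ.injective
  · intro u h
    simp only [Finset.mem_product, Finset.mem_filter, Finset.mem_univ, true_and, and_true] at h ⊢
    exact (Tuple.monotone_sort u).strictMono_of_injective (h.comp (Tuple.sort u).injective)
  · rintro ⟨u, τ⟩ h
    simp only [Finset.mem_product, Finset.mem_filter, Finset.mem_univ, true_and, and_true] at h
    have h1 : (u ∘ τ) ∘ Tuple.sort (u ∘ τ) = u := by
      rw [Tuple.comp_perm_comp_sort_eq_comp_sort, Tuple.sort_eq_refl_iff_monotone.2 h.monotone]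
      rfl
    refine Prod.ext h1 ?_
    rw [inv_eq_iff_mul_eq_one]
    ext i
    have h2 := congrFun h1 ((Tuple.sort (u ∘ τ))⁻¹ i)
    have h3 := h.injective h2
    simp at h3
    simp [h3]
  · intro u h
    rw [Function.comp_assoc, ← Perm.coe_mul]
    simp
  · intro p h
    rfl

/-- Words with a repeated letter contribute 0. Any other word is u ∘ τ with u increasing, and its
contribution does not depend on τ: the sign from the bottom word cancels the one from reindexing the
top. -/
theorem RightQuantum.sum_antisymmetrizer (hΨ : RightQuantum Ψ) :
    ∑ u : Fin n → A, ∑ a : Perm (Fin n), ((Perm.sign a : ℤ) : R) * Ψ (u ∘ a) u =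
      (n.factorial : R) * ∑ u : Fin n → A with StrictMono u,
        ∑ a : Perm (Fin n), ((Perm.sign a : ℤ) : R) * Ψ (u ∘ a) u := by
  have h1 : ∑ u : Fin n → A, ∑ a : Perm (Fin n), ((Perm.sign a : ℤ) : R) * Ψ (u ∘ a) u =
      ∑ u : Fin n → A with Function.Injective u,
        ∑ a : Perm (Fin n), ((Perm.sign a : ℤ) : R) * Ψ (u ∘ a) u := by
    rw [Finset.sum_filter]
    refine Finset.sum_congr rfl fun u _ => ?_
    split_ifs with h
    · rfl
    · exact alternating_sum_eq_zero h u
  rw [h1, sum_injective_eq, Finset.mul_sum]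
  refine Finset.sum_congr rfl fun u _ => ?_
  have : ∀ τ : Perm (Fin n), ∑ a : Perm (Fin n),
      ((Perm.sign a : ℤ) : R) * Ψ ((u ∘ τ) ∘ a) (u ∘ τ) =
      ∑ a : Perm (Fin n), ((Perm.sign a : ℤ) : R) * Ψ (u ∘ a) u := by
    intro τ
    rw [hΨ.alternating_sum_comp, ← Equiv.sum_comp (Equiv.mulLeft τ)
      (fun a : Perm (Fin n) => ((Perm.sign a : ℤ) : R) * Ψ (u ∘ a) u), Finset.mul_sum]
    refine Finset.sum_congr rfl fun a _ => ?_
    rw [Equiv.coe_mulLeft, Perm.sign_mul, Perm.coe_mul, ← Function.comp_assoc]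
    push_cast
    ring
  rw [Finset.sum_congr rfl fun τ _ => this τ, Finset.sum_const, Finset.card_univ,
    Fintype.card_perm, Fintype.card_fin, nsmul_eq_mul]

end SortedWords

end RightQuantum

/-! ### Right quantum functions of biwords and the Master Theorem -/

section Biwords

open Equiv Finset

variable {A R : Type*} [CommRing R] {Φ : List (A × A) → R}

/-- The biword with the top word `u` and the bottom word `v`. -/
def zipFn {n : ℕ} (u v : Fin n → A) : List (A × A) := List.ofFn fun i => (u i, v i)

/-- A function of biwords is right quantum if its symmetrization in two neighbouring bottom letters
is symmetric in the two top letters. -/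
def ListRightQuantum (Φ : List (A × A) → R) : Prop :=
  ∀ β₁ β₂ x y a b, Φ (β₁ ++ [(x, a), (y, b)] ++ β₂) + Φ (β₁ ++ [(x, b), (y, a)] ++ β₂) =
    Φ (β₁ ++ [(y, a), (x, b)] ++ β₂) + Φ (β₁ ++ [(y, b), (x, a)] ++ β₂)

/-- One pair of contexts serves all g that agree with f off i and j, so the four terms of the
relation share them. -/
theorem exists_ofFn_eq_append {X : Type*} {n : ℕ} (f : Fin n → X) {i j : Fin n}
    (hij : (i : ℕ) + 1 = j) : ∃ β₁ β₂ : List X, ∀ g : Fin n → X,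
      (∀ l, l ≠ i → l ≠ j → g l = f l) → List.ofFn g = β₁ ++ [g i, g j] ++ β₂ := by
  refine ⟨(List.ofFn f).take i, (List.ofFn f).drop (i + 2), fun g hg => ?_⟩
  have hj := j.2
  refine List.ext_getElem (by simp; omega) fun l h1 h2 => ?_
  have hl : l < n := by simpa using h1
  rcases lt_trichotomy l i with h | h | h
  · have := hg ⟨l, hl⟩ (by simp [Fin.ext_iff]; omega) (by simp [Fin.ext_iff]; omega)
    simp [h, this]
  · subst h
    simp
  · by_cases h' : l = j
    · have hj' : (⟨(i : ℕ) + 1, by omega⟩ : Fin n) = j := Fin.ext hij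
      subst h'
      simp [← hij, hj']
    · have := hg ⟨l, hl⟩ (by simp [Fin.ext_iff]; omega) (by simp [Fin.ext_iff]; omega)
      have h3 : (i : ℕ) + 2 + (l - (i + 2)) = l := by omega
      rw [List.getElem_append_right (by simp; omega)]
      simp [this, h3]

theorem ListRightQuantum.rightQuantum (hΦ : ListRightQuantum Φ) (n : ℕ) :
    RightQuantum fun u v : Fin n → A => Φ (zipFn u v) := by
  intro i j hij u v
  obtain ⟨β₁, β₂, h⟩ := exists_ofFn_eq_append (fun l => (u l, v l)) hij
  have hs : ∀ l, l ≠ i → l ≠ j → swap i j l = l := fun l => swap_apply_of_ne_of_ne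
  simp only [zipFn]
  rw [h _ fun l _ _ => rfl, h _ fun l h1 h2 => by simp [hs l h1 h2],
    h (fun l => ((u ∘ swap i j) l, v l)) fun l h1 h2 => by simp [hs l h1 h2],
    h (fun l => ((u ∘ swap i j) l, (v ∘ swap i j) l)) fun l h1 h2 => by simp [hs l h1 h2]]
  simpa using hΦ β₁ β₂ (u i) (u j) (v i) (v j)

theorem ListRightQuantum.append_left (hΦ : ListRightQuantum Φ) (α : List (A × A)) :
    ListRightQuantum fun β => Φ (α ++ β) := by
  intro β₁ β₂ x y a b
  simpa using hΦ (α ++ β₁) β₂ x y a b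

theorem ListRightQuantum.append_right (hΦ : ListRightQuantum Φ) (α : List (A × A)) :
    ListRightQuantum fun β => Φ (β ++ α) := by
  intro β₁ β₂ x y a b
  simpa using hΦ β₁ (β₂ ++ α) x y a b

theorem zipFn_append {k m : ℕ} (u v : Fin k → A) (u' v' : Fin m → A) :
    zipFn (Fin.append u u') (Fin.append v v') = zipFn u v ++ zipFn u' v' := by
  rw [zipFn, zipFn, zipFn, ← List.ofFn_fin_append]
  congr 1
  ext1 i
  refine Fin.addCases (fun i => ?_) (fun i => ?_) i <;> simp

/-- The first `k` elements of `Fin (k + m)`. -/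
def castAddEquiv (k m : ℕ) : Fin k ≃ {i : Fin (k + m) // (i : ℕ) < k} where
  toFun i := ⟨Fin.castAdd m i, i.2⟩
  invFun i := ⟨i.1, i.2⟩
  left_inv _ := rfl
  right_inv _ := rfl

/-- The last `m` elements of `Fin (k + m)`. -/
def natAddEquiv (k m : ℕ) : Fin m ≃ {i : Fin (k + m) // k ≤ (i : ℕ)} where
  toFun i := ⟨Fin.natAdd k i, by simp⟩
  invFun i := ⟨i.1 - k, by omega⟩
  left_inv i := by simp
  right_inv i := by ext; simp; omega

theorem append_comp_extendDomain {k m : ℕ} (u : Fin k → A) (w : Fin m → A) (a : Perm (Fin k))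
    (b : Perm (Fin m)) :
    Fin.append u w ∘ (b.extendDomain (natAddEquiv k m) * a.extendDomain (castAddEquiv k m)) =
      Fin.append (u ∘ a) (w ∘ b) := by
  ext i
  refine Fin.addCases (fun i => ?_) (fun i => ?_) i
  · have h := Perm.extendDomain_apply_image a (castAddEquiv k m) i
    have h' := Perm.extendDomain_apply_not_subtype b (natAddEquiv k m)
      (b := Fin.castAdd m (a i)) (by simp)
    simp only [castAddEquiv, Equiv.coe_fn_mk] at h
    simp only [Function.comp_apply, Perm.mul_apply, castAddEquiv, h, h', Fin.append_left]
  · have h := Perm.extendDomain_apply_image b (natAddEquiv k m) i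
    have h' := Perm.extendDomain_apply_not_subtype a (castAddEquiv k m)
      (b := Fin.natAdd k i) (by simp)
    simp only [natAddEquiv, Equiv.coe_fn_mk] at h
    simp only [Function.comp_apply, Perm.mul_apply, natAddEquiv, h, h', Fin.append_right]

variable [Fintype A] [LinearOrder A]

/-- The sum of `sign a * Φ (u a w̄ over u w)` over the increasing words `u` of length `k`, the
permutations `a`, and the words `w` of length `m`. -/
def fermBosSum (Φ : List (A × A) → R) (k m : ℕ) : R :=
  ∑ u : Fin k → A with StrictMono u, ∑ a : Perm (Fin k), ((Perm.sign a : ℤ) : R) *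
    ∑ w : Fin m → A, Φ (zipFn (u ∘ a) u ++ zipFn (w ∘ Tuple.sort w) w)

theorem fermBosSum_zero (Φ : List (A × A) → R) :
    fermBosSum Φ 0 0 = Φ [] := by
  rw [fermBosSum, Finset.filter_true_of_mem fun u _ => Subsingleton.strictMono u]
  simp [zipFn]

variable [IsDomain R] [CharZero R]

theorem ListRightQuantum.hookSum_eq (hΦ : ListRightQuantum Φ) (k m : ℕ) :
    hookSum (twistedTrace fun u v => Φ (zipFn u v)) (firstFin (k + m) k) (lastFin (k + m) k) =
      (k.factorial : R) * ((m.factorial : R) * fermBosSum Φ k m) := by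
  have h1 : hookSum (twistedTrace fun u v => Φ (zipFn u v)) (firstFin (k + m) k)
      (lastFin (k + m) k) = ∑ b : Perm (Fin m), ∑ a : Perm (Fin k), ∑ w : Fin m → A,
        ∑ u : Fin k → A, ((Perm.sign a : ℤ) : R) * Φ (zipFn (u ∘ a) u ++ zipFn (w ∘ b) w) := by
    rw [hookSum, lastFin, sum_permsOn_filter (natAddEquiv k m)]
    refine Finset.sum_congr rfl fun b _ => ?_
    rw [firstFin, sum_permsOn_filter (castAddEquiv k m)]
    refine Finset.sum_congr rfl fun a _ => ?_
    rw [Perm.sign_extendDomain, twistedTrace, ← (Fin.appendEquiv k m).sum_comp,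
      Fintype.sum_prod_type_right, Finset.mul_sum]
    refine Finset.sum_congr rfl fun w _ => ?_
    rw [Finset.mul_sum]
    refine Finset.sum_congr rfl fun u _ => ?_
    rw [show Fin.appendEquiv k m (u, w) = Fin.append u w from rfl, append_comp_extendDomain, zipFn_append]
  have h2 : ∀ (b : Perm (Fin m)) (w : Fin m → A), ∑ a : Perm (Fin k), ∑ u : Fin k → A,
      ((Perm.sign a : ℤ) : R) * Φ (zipFn (u ∘ a) u ++ zipFn (w ∘ b) w) =
      (k.factorial : R) * ∑ u : Fin k → A with StrictMono u, ∑ a : Perm (Fin k),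
        ((Perm.sign a : ℤ) : R) * Φ (zipFn (u ∘ a) u ++ zipFn (w ∘ b) w) := fun b w => by
    rw [Finset.sum_comm]
    exact ((hΦ.append_right (zipFn (w ∘ b) w)).rightQuantum k).sum_antisymmetrizer
  have h3 : ∀ (u : Fin k → A) (a : Perm (Fin k)), ∑ b : Perm (Fin m), ∑ w : Fin m → A,
      ((Perm.sign a : ℤ) : R) * Φ (zipFn (u ∘ a) u ++ zipFn (w ∘ b) w) =
      (m.factorial : R) * (((Perm.sign a : ℤ) : R) *
        ∑ w : Fin m → A, Φ (zipFn (u ∘ a) u ++ zipFn (w ∘ Tuple.sort w) w)) := fun u a => by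
    simp only [← Finset.mul_sum]
    rw [Finset.sum_comm,
      ((hΦ.append_left (zipFn (u ∘ a) u)).rightQuantum m).sum_symmetrizer]
    ring
  rw [h1, Finset.sum_congr rfl fun b _ => Finset.sum_comm.trans
    (Finset.sum_congr rfl fun w _ => h2 b w)]
  simp only [← Finset.mul_sum (a := (k.factorial : R))]
  simp only [fermBosSum, Finset.mul_sum (a := (m.factorial : R)), ← h3]
  congr 1
  rw [Finset.sum_congr rfl fun b _ => Finset.sum_comm, Finset.sum_comm]
  refine Finset.sum_congr rfl fun u _ => ?_
  rw [Finset.sum_congr rfl fun b _ => Finset.sum_comm, Finset.sum_comm]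

/-- The quantum MacMahon Master Theorem: the product of the fermionic and the bosonic sum is `1`
for every right quantum function. -/
theorem ListRightQuantum.sum_fermBosSum (hΦ : ListRightQuantum Φ) {n : ℕ} (hn : n ≠ 0) :
    ∑ k ∈ Finset.range (n + 1), (-1) ^ k * fermBosSum Φ k (n - k) = 0 := by
  have h := sum_choose_mul_hookSum (n := n) (χ := twistedTrace fun u v => Φ (zipFn u v))
    (fun k => (hΦ.rightQuantum n).leftAlternating ?_)
    (fun k => (hΦ.rightQuantum n).rightInvariant ?_)
  · have h' : ∀ k ∈ Finset.range (n + 1), (-1) ^ k * (n.choose k : R) * ((n : R) *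
        hookSum (twistedTrace fun u v => Φ (zipFn u v)) (firstFin n k) (lastFin n k)) =
        ((n * n.factorial : ℕ) : R) * ((-1) ^ k * fermBosSum Φ k (n - k)) := by
      intro k hk
      obtain ⟨m, rfl⟩ := Nat.exists_eq_add_of_le (Nat.lt_succ_iff.1 (Finset.mem_range.1 hk))
      rw [hΦ.hookSum_eq, ← Nat.choose_mul_factorial_mul_factorial (Nat.le_add_right k m),
        Nat.add_sub_cancel_left]
      push_cast
      ring
    rw [Finset.sum_congr rfl h', ← Finset.mul_sum] at h
    refine (mul_eq_zero.1 h).resolve_left ?_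
    exact Nat.cast_ne_zero.2 (mul_ne_zero hn n.factorial_ne_zero)
  · refine ⟨fun x hx y hy z hz => ?_⟩
    simp only [Finset.mem_coe, mem_firstFin] at *
    exact lt_of_le_of_lt hz.2 hy
  · refine ⟨fun x hx y hy z hz => ?_⟩
    simp only [Finset.mem_coe, mem_lastFin] at *
    exact le_trans hx hz.1

end Biwords

/-! ### The statistics are invariant under the contextual reduction -/

section Statistics

variable {r : ℕ}

theorem den_append (α β : Biword r) : den (α ++ β) =
    den α + den β + (α.map fun b => β.countP fun b' => InCyclicInterval b.2 b'.2 b'.1).sum := by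
  induction α with
  | nil => simp [den]
  | cons b α ih => simp only [List.cons_append, den, ih, List.countP_append, List.map_cons,
      List.sum_cons]; omega

/-- A factor interacts with the letters before it only through its cyclic intervals, and with those
after it only through its bottom letters. -/
theorem den_append_append_congr {α α' : Biword r} (β₁ β₂ : Biword r)
    (h1 : ∀ c, (α.countP fun b => InCyclicInterval c b.2 b.1) =
      α'.countP fun b => InCyclicInterval c b.2 b.1)
    (h2 : (α.map Prod.snd).Perm (α'.map Prod.snd)) (h3 : den α = den α') :
    den (β₁ ++ α ++ β₂) = den (β₁ ++ α' ++ β₂) := by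
  have h4 : (α.map fun b => β₂.countP fun b' => InCyclicInterval b.2 b'.2 b'.1).sum =
      (α'.map fun b => β₂.countP fun b' => InCyclicInterval b.2 b'.2 b'.1).sum := by
    have := (h2.map fun c => β₂.countP fun b' => InCyclicInterval c b'.2 b'.1).sum_eq
    simpa [Function.comp_def] using this
  simp only [den_append, List.map_append, List.sum_append, h1, h3, h4]

/-- Two biwords have the same statistics if their top words are rearrangements of each other and
the statistics `exc` and `den` agree. -/
def SameStatistics (β γ : Biword r) : Prop :=
  (β.map Prod.fst).Perm (γ.map Prod.fst) ∧ exc β = exc γ ∧ den β = den γ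

theorem SameStatistics.trans {β γ δ : Biword r} (h : SameStatistics β γ)
    (h' : SameStatistics γ δ) : SameStatistics β δ :=
  ⟨h.1.trans h'.1, h.2.1.trans h'.2.1, h.2.2.trans h'.2.2⟩

theorem sub_half_pos_iff (a x : ℕ) : (0 : ℚ) < a - x - 1 / 2 ↔ x < a := by
  constructor
  · intro h
    have : (x : ℚ) < a := by linarith
    exact_mod_cast this
  · intro h
    have : (x : ℚ) + 1 ≤ a := by exact_mod_cast h
    linarith

theorem sub_half_neg_iff (a x : ℕ) : (a - x - 1 / 2 : ℚ) < 0 ↔ ¬ x < a := by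
  rw [← sub_half_pos_iff, not_lt, le_iff_lt_or_eq, or_iff_left]
  intro h
  have h1 : ((2 * a : ℕ) : ℚ) = ((2 * x + 1 : ℕ) : ℚ) := by push_cast; linarith
  have := Nat.cast_injective (R := ℚ) h1
  omega

theorem mul_pos_iff_of_ne_zero {s t : ℚ} (hs : s ≠ 0) (ht : t ≠ 0) :
    0 < s * t ↔ (0 < s ↔ 0 < t) := by
  rcases hs.lt_or_gt with hs | hs <;> rcases ht.lt_or_gt with ht | ht
  · simp [mul_pos_of_neg_of_neg hs ht, hs.not_gt, ht.not_gt]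
  · simp [(mul_neg_of_neg_of_pos hs ht).not_gt, hs.not_gt, ht]
  · simp [(mul_neg_of_pos_of_neg hs ht).not_gt, hs, ht.not_gt]
  · simp [mul_pos hs ht, hs, ht]

theorem sub_half_ne_zero (a x : ℕ) : (a - x - 1 / 2 : ℚ) ≠ 0 := by
  by_cases h : x < a
  · exact ((sub_half_pos_iff a x).2 h).ne'
  · exact ((sub_half_neg_iff a x).2 h).ne

theorem contextV_ne_zero (x y a b : Fin r) : contextV x y a b ≠ 0 := by
  simp only [contextV, ne_eq, mul_eq_zero, sub_half_ne_zero, or_self, not_false_eq_true]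

/-- Say that a separates x and y if exactly one of them is less than a. Then V > 0 means that both
or neither of a and b separate x and y, and V < 0 that exactly one does. -/
theorem contextV_pos_iff (x y a b : Fin r) :
    0 < contextV x y a b ↔ ((x < a ↔ y < a) ↔ (x < b ↔ y < b)) := by
  have h := sub_half_ne_zero
  rw [contextV, mul_pos_iff_of_ne_zero (mul_ne_zero (h _ _) (h _ _))
    (mul_ne_zero (h _ _) (h _ _)), mul_pos_iff_of_ne_zero (h _ _) (h _ _),
    mul_pos_iff_of_ne_zero (h _ _) (h _ _)]
  simp only [sub_half_pos_iff, Fin.lt_def]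

theorem contextV_comm (x y a b : Fin r) : contextV x y b a = contextV x y a b := by
  simp only [contextV]; ring

theorem sameStatistics_of_contextV_pos {x y a b : Fin r} (hxy : y < x)
    (hV : 0 < contextV x y a b) (β₁ β₂ : Biword r) :
    SameStatistics (β₁ ++ [(x, a), (y, b)] ++ β₂) (β₁ ++ [(y, a), (x, b)] ++ β₂) := by
  rw [contextV_pos_iff] at hV
  simp only [Fin.lt_def] at hV hxy
  refine ⟨?_, ?_, den_append_append_congr _ _ (fun c => ?_) ?_ ?_⟩
  · simpa using ((List.Perm.swap y x _).append_left _)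
  · simp only [exc, List.countP_append, List.countP_cons, List.countP_nil, decide_eq_true_eq,
      Fin.lt_def]
    split_ifs <;> omega
  · simp only [List.countP_cons, List.countP_nil, decide_eq_true_eq, InCyclicInterval, Fin.lt_def,
      Fin.le_def]
    split_ifs <;> omega
  · simp
  · simp only [den, List.countP_cons, List.countP_nil, decide_eq_true_eq, InCyclicInterval,
      Fin.lt_def, Fin.le_def]
    split_ifs <;> omega

theorem sameStatistics_of_contextV_neg {x y a b : Fin r} (hxy : y < x)
    (hV : contextV x y a b < 0) (β₁ β₂ : Biword r) :
    SameStatistics (β₁ ++ [(x, a), (y, b)] ++ β₂) (β₁ ++ [(y, b), (x, a)] ++ β₂) := by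
  have hV := (contextV_pos_iff x y a b).not.1 hV.not_gt
  simp only [Fin.lt_def] at hV hxy
  refine ⟨?_, ?_, den_append_append_congr _ _ (fun c => ?_) ?_ ?_⟩
  · simpa using ((List.Perm.swap y x _).append_left _)
  · simp only [exc, List.countP_append, List.countP_cons, List.countP_nil]
    omega
  · simp only [List.countP_cons, List.countP_nil]
    omega
  · simpa using List.Perm.swap b a []
  · simp only [den, List.countP_cons, List.countP_nil, decide_eq_true_eq, InCyclicInterval,
      Fin.lt_def, Fin.le_def]
    split_ifs <;> omega

end Statistics

/-! ### The leftmost reduction for the contextual system -/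

section Reduction

variable {r : ℕ}

theorem exists_leftmost_descent {X : Type*} {p : X → X → Prop} (l : List X)
    (hl : ¬ l.IsChain p) : ∃ l₁ x y l₂, l = l₁ ++ [x] ++ [y] ++ l₂ ∧ (l₁ ++ [x]).IsChain p ∧
      ¬ p x y := by
  induction l using List.reverseRecOn with
  | nil => simp at hl
  | append_singleton l z ih =>
    by_cases h : l.IsChain p
    · rcases List.eq_nil_or_concat l with rfl | ⟨l₁, x, rfl⟩
      · simp at hl
      · rw [List.concat_eq_append] at *
        refine ⟨l₁, x, z, [], by simp, h, fun hp => hl ?_⟩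
        rw [List.isChain_append]
        refine ⟨h, by simp, ?_⟩
        simpa using hp
    · obtain ⟨l₁, x, y, l₂, rfl, h1, h2⟩ := ih h
      exact ⟨l₁, x, y, l₂ ++ [z], by simp, h1, h2⟩

theorem SH_irreducible_of_isChain {β : Biword r} (h : β.IsChain fun b b' => b.1 ≤ b'.1) :
    (SH r).Irreducible β := by
  rintro p ⟨x, y, a, b, hxy, ⟨-, rfl⟩ | ⟨-, rfl⟩⟩ hp <;>
  · have := h.infix hp
    simp at this
    exact absurd hxy (not_lt.2 this)

theorem isChain_of_isEmpty_leftmostRedex {β : Biword r}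
    (h : ¬ Nonempty ((SH r).LeftmostRedex β)) : β.IsChain fun b b' => b.1 ≤ b'.1 := by
  by_contra hβ
  obtain ⟨β₁, ⟨x, a⟩, ⟨y, b⟩, β₃, rfl, h1, h2⟩ := exists_leftmost_descent β hβ
  have hxy : y < x := not_le.1 h2
  rcases (contextV_ne_zero x y a b).lt_or_gt with hV | hV
  · exact h ⟨⟨β₁, [(x, a)], (y, b), β₃, _, by simp, SH_irreducible_of_isChain h1,
      ⟨x, y, a, b, hxy, Or.inr ⟨hV, rfl⟩⟩⟩⟩
  · exact h ⟨⟨β₁, [(x, a)], (y, b), β₃, _, by simp, SH_irreducible_of_isChain h1,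
      ⟨x, y, a, b, hxy, Or.inl ⟨hV, rfl⟩⟩⟩⟩

theorem sum_support_smul_of_eq_single {X M : Type*} [AddCommMonoid M] [Module CoeffQ M]
    {E : X →₀ CoeffQ} {δ : X} (h : E = Finsupp.single δ 1) (F : X → M) :
    ∑ γ : E.support, E γ.1 • F γ.1 = F δ := by
  rw [Finset.sum_coe_sort E.support fun γ => E γ • F γ, h, Finsupp.support_single _ one_ne_zero]
  simp

/-- The leftmost reduction of a biword is a single biword with a non-decreasing top word and with
the same statistics. -/
theorem exists_reduceBiword_eq_single (β : Biword r) : ∃ γ : Biword r,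
    (SH r).reduceBiword β = Finsupp.single γ 1 ∧ (γ.map Prod.fst).IsChain (· ≤ ·) ∧
      SameStatistics β γ := by
  induction β using (SH r).dcc.induction with
  | _ β ih =>
  by_cases h : Nonempty ((SH r).LeftmostRedex β)
  · obtain ⟨δ, hE, hδ⟩ : ∃ δ, h.some.E = Finsupp.single δ 1 ∧
        SameStatistics β (h.some.β₁ ++ δ ++ h.some.β₃) := by
      obtain ⟨x, y, a, b, hxy, ⟨hV, hp⟩ | ⟨hV, hp⟩⟩ := h.some.mem <;>
      · rw [Prod.mk.injEq] at hp
        refine ⟨_, hp.2, ?_⟩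
        have := h.some.eq
        rw [hp.1] at this
        -- Only the first argument may be rewritten: the chosen redex in the second depends on `β`
        -- itself.
        conv_lhs => rw [this]
        first
        | exact sameStatistics_of_contextV_pos hxy hV _ _
        | exact sameStatistics_of_contextV_neg hxy hV _ _
    rw [ReductionSystem.reduceBiword_of_nonempty _ _ h, sum_support_smul_of_eq_single hE
      (fun γ => (SH r).reduceBiword (h.some.β₁ ++ γ ++ h.some.β₃))]
    obtain ⟨γ, h1, h2, h3⟩ := ih _ (h.some.edge ⟨δ, by
      rw [hE, Finsupp.support_single _ one_ne_zero]; simp⟩)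
    exact ⟨γ, h1, h2, hδ.trans h3⟩
  · refine ⟨β, ReductionSystem.reduceBiword_of_isEmpty _ _ h, ?_, List.Perm.refl _, rfl, rfl⟩
    rw [List.isChain_map]
    exact isChain_of_isEmpty_leftmostRedex h

end Reduction

/-! ### The weight of a biword -/

section Weight

variable {r : ℕ}

/-- The weight `t ^ exc β * q ^ den β`. -/
noncomputable def biwordWeight (β : Biword r) : CoeffTQ :=
  LaurentPolynomial.T (exc β) * LaurentPolynomial.C (LaurentPolynomial.T (den β))

/-- The weight of a biword if its top word is a rearrangement of `u`, and `0` otherwise. -/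
noncomputable def classWeight (u : List (Fin r)) (β : Biword r) : CoeffTQ :=
  if (β.map Prod.fst).Perm u then biwordWeight β else 0

theorem SameStatistics.biwordWeight_eq {β γ : Biword r} (h : SameStatistics β γ) :
    biwordWeight β = biwordWeight γ := by
  rw [biwordWeight, biwordWeight, h.2.1, h.2.2]

theorem SameStatistics.classWeight_eq {β γ : Biword r} (h : SameStatistics β γ)
    (u : List (Fin r)) : classWeight u β = classWeight u γ := by
  rw [classWeight, classWeight, h.biwordWeight_eq]
  congr 1
  exact propext ⟨fun h' => h.1.symm.trans h', fun h' => h.1.trans h'⟩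

theorem listRightQuantum_classWeight (u : List (Fin r)) :
    ListRightQuantum (classWeight u) := by
  have key : ∀ β₁ β₂ : Biword r, ∀ x y a b : Fin r, y < x →
      classWeight u (β₁ ++ [(x, a), (y, b)] ++ β₂) + classWeight u (β₁ ++ [(x, b), (y, a)] ++ β₂) =
      classWeight u (β₁ ++ [(y, a), (x, b)] ++ β₂) +
        classWeight u (β₁ ++ [(y, b), (x, a)] ++ β₂) := by
    intro β₁ β₂ x y a b hxy
    have hc := contextV_comm x y a b
    rcases (contextV_ne_zero x y a b).lt_or_gt with hV | hV
    · rw [(sameStatistics_of_contextV_neg hxy hV _ _).classWeight_eq,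
        (sameStatistics_of_contextV_neg hxy (hc ▸ hV) _ _).classWeight_eq, add_comm]
    · rw [(sameStatistics_of_contextV_pos hxy hV _ _).classWeight_eq,
        (sameStatistics_of_contextV_pos hxy (hc ▸ hV) _ _).classWeight_eq]
  intro β₁ β₂ x y a b
  rcases lt_trichotomy x y with h | rfl | h
  · rw [key β₁ β₂ y x a b h]
  · rfl
  · exact key β₁ β₂ x y a b h

theorem sum_ite_eq_zip {M : Type*} [AddCommMonoid M] (γ : Biword r) (u : List (Fin r)) (g : M) :
    ∑ v : Fin u.length → Fin r, (if γ = List.ofFn fun i => (u.get i, v i) then g else 0) =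
      if γ.map Prod.fst = u then g else 0 := by
  split_ifs with h
  · subst h
    rw [Finset.sum_eq_single (fun i => (γ[i]'(by simpa using i.2)).2), if_pos]
    · refine List.ext_getElem (by simp) fun i h1 h2 => ?_
      simp
    · intro v _ hv
      rw [if_neg]
      intro h
      apply hv
      ext1 i
      have hi : (i : ℕ) < γ.length := by simpa using i.2
      have := List.getElem_of_eq h hi
      rw [List.getElem_ofFn] at this
      exact (congrArg Prod.snd this).symm
    · simp
  · refine Finset.sum_eq_zero fun v _ => if_neg fun h' => h ?_
    rw [h', List.map_ofFn]
    exact List.ofFn_get u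

theorem leftmostReduction_apply (E : FormalSum CoeffQ (Biletter r)) {N : Biword r → Biword r}
    (hN : ∀ β, (SH r).reduceBiword β = Finsupp.single (N β) 1) (γ : Biword r) {n : ℕ}
    (hn : γ.length = n) :
    (SH r).leftmostReduction E γ =
      ∑ f : Fin n → Biletter r, E (List.ofFn f) * if N (List.ofFn f) = γ then 1 else 0 := by
  classical
  rw [ReductionSystem.leftmostReduction, finsum_eq_sum_of_support_subset
    (s := Finset.univ.map ⟨List.ofFn, List.ofFn_injective (n := n)⟩), Finset.sum_map]
  · refine Finset.sum_congr rfl fun f _ => ?_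
    rw [Function.Embedding.coeFn_mk, hN, Finsupp.single_apply]
  · intro β hβ
    have h := SH_reduceBiword_length β γ (right_ne_zero_of_mul hβ)
    subst hn
    simp only [Finset.coe_map, Function.Embedding.coeFn_mk, Finset.coe_univ, Set.image_univ,
      Set.mem_range]
    rw [h]
    exact ⟨β.get, List.ofFn_get β⟩

/-- Reduction sorts the top word and keeps the weight, so for sorted u the biwords reducing to top
word u are those whose top word is a rearrangement of u. -/
theorem psi_leftmostReduction_apply (E : FormalSum CoeffQ (Biletter r)) (u : List (Fin r)) :
    psi ((SH r).leftmostReduction E) u = if u.IsChain (· ≤ ·) then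
      ∑ f : Fin u.length → Biletter r,
        LaurentPolynomial.C (E (List.ofFn f)) * classWeight u (List.ofFn f) else 0 := by
  choose N hN hchain hstat using exists_reduceBiword_eq_single (r := r)
  have h1 : psi ((SH r).leftmostReduction E) u = ∑ f : Fin u.length → Biletter r,
      LaurentPolynomial.C (E (List.ofFn f)) *
        if (N (List.ofFn f)).map Prod.fst = u then biwordWeight (List.ofFn f) else 0 := by
    have h2 : ∀ f : Fin u.length → Biletter r, LaurentPolynomial.C (E (List.ofFn f)) *
        (if (N (List.ofFn f)).map Prod.fst = u then biwordWeight (List.ofFn f) else 0) =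
        ∑ v : Fin u.length → Fin r, LaurentPolynomial.C (E (List.ofFn f)) *
          if N (List.ofFn f) = List.ofFn fun i => (u.get i, v i) then
            biwordWeight (List.ofFn f) else 0 := by
      intro f
      rw [← sum_ite_eq_zip, Finset.mul_sum]
    rw [Finset.sum_congr rfl fun f _ => h2 f, Finset.sum_comm]
    refine Finset.sum_congr rfl fun v _ => ?_
    dsimp only
    rw [leftmostReduction_apply E hN _ (n := u.length) (by simp), map_sum, Finset.sum_mul]
    refine Finset.sum_congr rfl fun f _ => ?_
    split_ifs with h
    · rw [(hstat _).biwordWeight_eq, h, mul_one, biwordWeight]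
    · simp
  rw [h1]
  split_ifs with hu
  · refine Finset.sum_congr rfl fun f _ => ?_
    rw [classWeight]
    congr 2
    refine propext ⟨fun h => (hstat _).1.trans (List.Perm.of_eq h), fun h => ?_⟩
    exact ((hstat _).1.symm.trans h).eq_of_pairwise' (hchain _).pairwise hu.pairwise
  · refine Finset.sum_eq_zero fun f _ => ?_
    rw [if_neg, mul_zero]
    intro h
    exact hu (h ▸ hchain _)

end Weight

/-! ### The product of the fermionic and the bosonic sum -/

section FermBos

open Equiv Finset

variable {r : ℕ}

theorem neg_one_pow_countP {X : Type*} (p : X → Bool) (l : List X) :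
    (-1 : ℤ) ^ l.countP p = (l.map fun y => if p y then (-1 : ℤ) else 1).prod := by
  induction l with
  | nil => simp
  | cons y l ih => rw [List.countP_cons, pow_add, ih, List.map_cons, List.prod_cons, mul_comm]
                   split_ifs <;> simp

theorem neg_one_pow_wordInv {n : ℕ} (w : Fin n → Fin r) :
    (-1 : ℤ) ^ wordInv (List.ofFn w) =
      ∏ i, ∏ j ∈ Finset.Ioi i, if w j < w i then (-1 : ℤ) else 1 := by
  induction n with
  | zero => simp [wordInv]
  | succ n ih =>
    rw [List.ofFn_succ, wordInv, pow_add, ih, neg_one_pow_countP, Fin.prod_univ_succ,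
      Fin.prod_Ioi_zero, List.map_ofFn, List.prod_ofFn]
    congr 1
    · simp
    · refine Finset.prod_congr rfl fun i _ => ?_
      rw [Fin.prod_Ioi_succ]

/-- An increasing u preserves inversions, so the fermionic weight at c = 1 is the sign of the
permutation. -/
theorem neg_one_pow_wordInv_comp {n : ℕ} {u : Fin n → Fin r} (hu : StrictMono u)
    (a : Perm (Fin n)) : (-1 : ℤ) ^ wordInv (List.ofFn (u ∘ a)) = (Perm.sign a : ℤ) := by
  rw [neg_one_pow_wordInv, Perm.sign_eq_prod_prod_Ioi]
  push_cast
  refine Finset.prod_congr rfl fun i _ => Finset.prod_congr rfl fun j hj => ?_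
  have hij : a i ≠ a j := fun h => (Finset.mem_Ioi.1 hj).ne (a.injective h)
  simp only [Function.comp_apply, hu.lt_iff_lt]
  rcases hij.lt_or_gt with h | h
  · rw [if_neg h.not_gt, if_pos h]; rfl
  · rw [if_pos h, if_neg h.not_gt]; rfl

theorem insertionSort_ofFn {m : ℕ} (w : Fin m → Fin r) :
    (List.ofFn w).insertionSort (· ≤ ·) = List.ofFn (w ∘ Tuple.sort w) := by
  refine List.Perm.eq_of_pairwise' (r := (· ≤ ·)) (List.pairwise_insertionSort _ _) ?_
    ((List.perm_insertionSort _ _).trans (Equiv.Perm.ofFn_comp_perm (Tuple.sort w) w).symm)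
  rw [List.pairwise_ofFn]
  exact fun i j hij => Tuple.monotone_sort w hij.le

variable {R : Type*} [CommRing R]

theorem sum_Bos_mul (φ : CoeffQ →+* R) (m : ℕ) (F : Biword r → R) :
    ∑ h : Fin m → Biletter r, φ (Bos r 1 (List.ofFn h)) * F (List.ofFn h) =
      ∑ w : Fin m → Fin r, F (zipFn (w ∘ Tuple.sort w) w) := by
  rw [← (Equiv.arrowProdEquivProdArrow (Fin m) (fun _ => Fin r) (fun _ => Fin r)).symm.sum_comp,
    Fintype.sum_prod_type_right]
  refine Finset.sum_congr rfl fun w _ => ?_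
  have h1 : ∀ u : Fin m → Fin r, Bos r 1 (zipFn u w) = if u = w ∘ Tuple.sort w then 1 else 0 := by
    intro u
    have h2 : (zipFn u w).map Prod.fst = List.ofFn u := by
      simp [zipFn, List.map_ofFn, Function.comp_def]
    have h3 : (zipFn u w).map Prod.snd = List.ofFn w := by
      simp [zipFn, List.map_ofFn, Function.comp_def]
    rw [Bos, h2, h3, insertionSort_ofFn, one_pow]
    congr 1
    exact propext List.ofFn_inj
  have h4 : ∀ u : Fin m → Fin r, φ (Bos r 1 (zipFn u w)) * F (zipFn u w) =
      if u = w ∘ Tuple.sort w then F (zipFn u w) else 0 := by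
    intro u
    rw [h1]
    split_ifs <;> simp
  refine (Finset.sum_congr rfl fun u _ => h4 u).trans ?_
  simp

/-- The signed sum of `F` over the biwords with the bottom word `J` and with the top word a
permutation of `J`. -/
theorem sum_permBiword {k : ℕ} (J : Finset (Fin r)) (hJ : J.card = k) (F : Biword r → R) :
    ∑ σ : Perm J, (-1 : R) ^ wordInv ((permBiword J σ).map Prod.fst) * F (permBiword J σ) =
      ∑ a : Perm (Fin k), ((Perm.sign a : ℤ) : R) *
        F (zipFn (J.orderEmbOfFin hJ ∘ a) (J.orderEmbOfFin hJ)) := by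
  subst hJ
  rw [← ((J.orderIsoOfFin rfl).toEquiv.permCongr).sum_comp]
  refine Finset.sum_congr rfl fun a _ => ?_
  have h1 : permBiword J ((J.orderIsoOfFin rfl).toEquiv.permCongr a) =
      zipFn (J.orderEmbOfFin rfl ∘ a) (J.orderEmbOfFin rfl) := by
    simp [permBiword, zipFn]
  rw [h1, ← neg_one_pow_wordInv_comp (J.orderEmbOfFin rfl).strictMono a]
  simp [zipFn, List.map_ofFn, Function.comp_def]

theorem sum_strictMono_eq {M : Type*} [AddCommMonoid M] {k : ℕ} (G : (Fin k → Fin r) → M) :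
    ∑ u : Fin k → Fin r with StrictMono u, G u =
      ∑ J : Finset (Fin r), if hJ : J.card = k then G (J.orderEmbOfFin hJ) else 0 := by
  symm
  rw [← Finset.sum_subset (Finset.subset_univ (Finset.univ.filter fun J => J.card = k))]
  · refine Finset.sum_bij (fun J hJ => J.orderEmbOfFin (Finset.mem_filter.1 hJ).2) ?_ ?_ ?_ ?_
    · intro J hJ
      simp [OrderEmbedding.strictMono]
    · intro J hJ J' hJ' h
      have := congrArg Set.range h
      rw [Finset.range_orderEmbOfFin, Finset.range_orderEmbOfFin] at this
      exact_mod_cast this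
    · intro u hu
      have hu : StrictMono u := by simpa using hu
      refine ⟨Finset.univ.image u, ?_, ?_⟩
      · simp [Finset.card_image_of_injective _ hu.injective]
      · exact (Finset.orderEmbOfFin_unique _ (fun x => by simp) hu).symm
    · intro J hJ
      rw [dif_pos (Finset.mem_filter.1 hJ).2]
  · intro J _ hJ
    rw [dif_neg (by simpa using hJ)]

theorem sum_Ferm_mul (φ : CoeffQ →+* R) (k : ℕ) (F : Biword r → R) :
    ∑ g : Fin k → Biletter r, φ (Ferm r 1 (List.ofFn g)) * F (List.ofFn g) =
      (-1) ^ k * ∑ u : Fin k → Fin r with StrictMono u, ∑ a : Perm (Fin k),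
        ((Perm.sign a : ℤ) : R) * F (zipFn (u ∘ a) u) := by
  have h1 : ∀ g : Fin k → Biletter r, φ (Ferm r 1 (List.ofFn g)) * F (List.ofFn g) =
      ∑ J : Finset (Fin r), ∑ σ : Perm J, (-1) ^ J.card *
        ((-1) ^ wordInv ((permBiword J σ).map Prod.fst) *
          if List.ofFn g = permBiword J σ then F (permBiword J σ) else 0) := by
    intro g
    rw [Ferm, map_sum, Finset.sum_mul]
    refine Finset.sum_congr rfl fun J _ => ?_
    rw [map_mul, map_sum, Finset.mul_sum, Finset.sum_mul]
    refine Finset.sum_congr rfl fun σ _ => ?_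
    split_ifs with h
    · rw [h]; simp [mul_assoc]
    · simp
  rw [Finset.sum_congr rfl fun g _ => h1 g, Finset.sum_comm, sum_strictMono_eq, Finset.mul_sum]
  refine Finset.sum_congr rfl fun J _ => ?_
  rw [Finset.sum_comm]
  simp only [← Finset.mul_sum]
  split_ifs with hJ
  · rw [← sum_permBiword, hJ]
    congr 1
    refine Finset.sum_congr rfl fun σ _ => ?_
    congr 1
    subst hJ
    rw [Finset.sum_eq_single (fun i => ((σ (J.orderIsoOfFin rfl i) : Fin r),
      (J.orderIsoOfFin rfl i : Fin r)))]
    · exact if_pos rfl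
    · intro g _ hg
      exact if_neg fun h => hg (List.ofFn_injective h)
    · simp
  -- A biword built from J has length |J|, so subsets of any other size than k contribute nothing.
  · rw [mul_zero]
    convert mul_zero _
    refine Finset.sum_eq_zero fun σ _ => ?_
    convert mul_zero _
    refine Finset.sum_eq_zero fun g _ => if_neg fun h => hJ ?_
    have := congrArg List.length h
    simpa [permBiword] using this.symm

theorem sum_Ferm_mul_Bos (φ : CoeffQ →+* R) (n : ℕ) (Φ : Biword r → R) :
    ∑ f : Fin n → Biletter r, φ ((Ferm r 1 * Bos r 1) (List.ofFn f)) * Φ (List.ofFn f) =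
      ∑ k ∈ Finset.range (n + 1), (-1) ^ k * fermBosSum Φ k (n - k) := by
  have h1 : ∀ f : Fin n → Biletter r,
      φ ((Ferm r 1 * Bos r 1) (List.ofFn f)) * Φ (List.ofFn f) =
      ∑ k ∈ Finset.range (n + 1), φ (Ferm r 1 ((List.ofFn f).take k)) *
        (φ (Bos r 1 ((List.ofFn f).drop k)) * Φ (List.ofFn f)) := by
    intro f
    have : (Ferm r 1 * Bos r 1) (List.ofFn f) = ∑ i ∈ Finset.range ((List.ofFn f).length + 1),
      Ferm r 1 ((List.ofFn f).take i) * Bos r 1 ((List.ofFn f).drop i) := rfl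
    rw [this, map_sum, Finset.sum_mul, List.length_ofFn]
    simp only [map_mul, mul_assoc]
  rw [Finset.sum_congr rfl fun f _ => h1 f, Finset.sum_comm]
  refine Finset.sum_congr rfl fun k hk => ?_
  obtain ⟨m, rfl⟩ := Nat.exists_eq_add_of_le (Nat.lt_succ_iff.1 (Finset.mem_range.1 hk))
  rw [Nat.add_sub_cancel_left, ← (Fin.appendEquiv k m).sum_comp, Fintype.sum_prod_type]
  have h2 : ∀ (g : Fin k → Biletter r) (h : Fin m → Biletter r),
      List.ofFn (Fin.appendEquiv k m (g, h)) = List.ofFn g ++ List.ofFn h :=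
    fun g h => List.ofFn_fin_append g h
  simp only [h2, List.take_left' (List.length_ofFn (f := _)),
    List.drop_left' (List.length_ofFn (f := _)), ← Finset.mul_sum]
  rw [Finset.sum_congr rfl fun g _ => congrArg _
    (sum_Bos_mul φ m fun β => Φ (List.ofFn g ++ β)),
    sum_Ferm_mul φ k fun α => ∑ w : Fin m → Fin r, Φ (α ++ zipFn (w ∘ Tuple.sort w) w)]
  rfl

end FermBos

/-- Characteristic zero is what permits cancelling 2 in the right quantum relations and n · n! in
the Master Theorem. -/
theorem charZero_laurentPolynomial (R : Type*) [CommRing R] [CharZero R] : CharZero R[T;T⁻¹] := by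
  refine charZero_of_injective_ringHom (f := (LaurentPolynomial.C : R →+* R[T;T⁻¹])) ?_
  intro a b h
  have := congrArg (fun p : R[T;T⁻¹] => p.coeff 0) h
  rw [← LaurentPolynomial.single_eq_C, ← LaurentPolynomial.single_eq_C] at this
  simpa using this

theorem mainTheorem2 (r : ℕ) :
    psi ((SH r).leftmostReduction (Ferm r 1 * Bos r 1)) = 1 := by
  funext u
  rw [psi_leftmostReduction_apply, sum_Ferm_mul_Bos]
  have hone : (1 : FormalSum CoeffTQ (Fin r)) u = if u.isEmpty then 1 else 0 := rfl
  rw [hone]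
  rcases eq_or_ne u [] with rfl | hu
  · simp [fermBosSum_zero, classWeight, biwordWeight, exc, den]
  · have : CharZero CoeffQ := charZero_laurentPolynomial ℤ
    have : CharZero CoeffTQ := charZero_laurentPolynomial CoeffQ
    rw [(listRightQuantum_classWeight u).sum_fermBosSum
      (List.length_eq_zero_iff.not.2 hu)]
    simp [hu]
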